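/- Let $r>2$, $\mu\ge 1$, $a_1,a_2>0$, $a_3\in(0,\mu)$, $a_4\in(0,1]$. Let $1\le n<N$ be integers, and write $N=(1+\delta)n$. Let $\Gamma=(\xi_{ji})_{j\le N,\,i\le n}$ be a random $N\times n$ matrix whose entries are independent centered real random variables such that (i) $\mathbb E|\xi_{ji}|^r\le\mu^r$ for all $j,i$; (ii) $\mathbb P\bigl(\|\Gamma\|>a_1\sqrt N\bigr)\le e^{-a_2N}$, where $\|\Gamma\|$ is the operator norm from $\ell_2^n$ to $\ell_2^N$; (iii) $\sum_{j=1}^N\mathbb E\,\xi_{ji}^2\ge a_3^2N$ for every $i\le n$; (iv) $\bigl|\{i\le n:\ \mathbb E\,\xi_{ji}^2\ge 1\}\bigr|\ge a_4n$ for every $j\le N$. Then there exist a constant $\gamma\in(0,1)$ depending only on $r,\mu,a_1,a_3$, positive constants $c_2,\tilde c_1,\tilde c_2$ depending only on $r,\mu,a_1,a_2,a_3,a_4$, and a positive constant $c_1=c_1(r,\mu,a_1,a_3,\delta)$ depending only on $r,\mu,a_1,a_3$ and $\delta$, such that if $$a_4>1-\gamma\qquad\text{and}\qquad \delta\ge\frac{\tilde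 c_1}{\ln(2+\tilde c_2 n)},$$ then $$\mathbb P\bigl(s_n(\Gamma)\le c_1\sqrt N\bigr)\le e^{-c_2N},$$ where $s_n(\Gamma)$ is the smallest singular value of $\Gamma$, that is, the smallest eigenvalue of $\sqrt{\Gamma^t\Gamma}$. -/

import Mathlib

open MeasureTheory ProbabilityTheory

/-- The operator norm `ℓ₂ⁿ → ℓ₂ᴺ` of a real `N × n` matrix. -/
noncomputable def spectralNorm2 {N n : ℕ} (A : Matrix (Fin N) (Fin n) ℝ) : ℝ :=
  ‖LinearMap.toContinuousLinearMap (Matrix.toEuclideanLin A)‖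

/-- The smallest singular value `s_n(A)` of a real `N × n` matrix with `n ≥ 1`: the last of the
`n` eigenvalues of `√(Aᵗ A)` in decreasing order (Mathlib numbers the singular values from `0`). -/
noncomputable def smallestSingularValue {N n : ℕ} (A : Matrix (Fin N) (Fin n) ℝ) : ℝ :=
  (Matrix.toEuclideanLin A).singularValues (n - 1)

/-- The entries of the random matrix `Γ` are independent, centered real random variables. -/
structure HasIndepCenteredEntries {Ω : Type*} [MeasurableSpace Ω] (P : Measure Ω) {N n : ℕ}
    (Γ : Ω → Matrix (Fin N) (Fin n) ℝ) : Prop where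
  measurable_entry : ∀ j i, Measurable fun ω => Γ ω j i
  indep : iIndepFun (fun (p : Fin N × Fin n) ω => Γ ω p.1 p.2) P
  integrable_entry : ∀ j i, Integrable (fun ω => Γ ω j i) P
  centered : ∀ j i, ∫ ω, Γ ω j i ∂P = 0

/-- Condition (i): the `r`-th absolute moment of every entry is finite and at most `μ ^ r`. -/
def MomentCondition {Ω : Type*} [MeasurableSpace Ω] (P : Measure Ω) {N n : ℕ}
    (Γ : Ω → Matrix (Fin N) (Fin n) ℝ) (r μ : ℝ) : Prop :=
  ∀ j i, Integrable (fun ω => |Γ ω j i| ^ r) P ∧ ∫ ω, |Γ ω j i| ^ r ∂P ≤ μ ^ r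

/-- Condition (ii): `‖Γ‖ > a₁ √N` has probability at most `exp (-a₂ N)`. -/
def NormCondition {Ω : Type*} [MeasurableSpace Ω] (P : Measure Ω) {N n : ℕ}
    (Γ : Ω → Matrix (Fin N) (Fin n) ℝ) (a₁ a₂ : ℝ) : Prop :=
  P.real {ω | a₁ * √(N : ℝ) < spectralNorm2 (Γ ω)} ≤ Real.exp (-a₂ * N)

/-- Condition (iii): the second moments of the entries of each column sum to at least `a₃² N`. -/
def ColumnCondition {Ω : Type*} [MeasurableSpace Ω] (P : Measure Ω) {N n : ℕ}
    (Γ : Ω → Matrix (Fin N) (Fin n) ℝ) (a₃ : ℝ) : Prop :=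
  ∀ i, a₃ ^ 2 * N ≤ ∑ j, ∫ ω, (Γ ω j i) ^ 2 ∂P

/-- Condition (iv): each row has at least `a₄ n` entries with second moment at least `1`. -/
def RowCondition {Ω : Type*} [MeasurableSpace Ω] (P : Measure Ω) {N n : ℕ}
    (Γ : Ω → Matrix (Fin N) (Fin n) ℝ) (a₄ : ℝ) : Prop :=
  ∀ j, a₄ * n ≤ (Set.ncard {i : Fin n | 1 ≤ ∫ ω, (Γ ω j i) ^ 2 ∂P} : ℝ)

/-!
A singular value below `c * √N` yields a unit vector `x` with `‖Γ x‖ ≤ c * √N`. Such an `x` is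
excluded by a union bound over two nets of lattice points; off the event that `‖Γ‖ > a₁ * √N`,
passing from `x` to a nearby net point `z` costs little.

For a single `z`, everything comes from characteristic functions. Averaging over a standard Gaussian
`g` gives `E exp (-(s X) ^ 2 / 2) ≤ E |φ_X (s g)|`
(`integral_exp_neg_sq_le_integral_norm_charFun`). Each entry has
`|φ t| ≤ exp (-t ^ 2 * σ ^ 2 / 2 + 4 * (μ |t|) ^ p)` for all `t`, where `σ ^ 2` is its variance
and `p = min r 3` (`norm_charFun_map_le_exp`). Multiplying over a row and then over the rows, and
applying Markov's inequality, yields two estimates.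

* At a constant scale `s`, the column condition gives `P (‖Γ z‖ ≤ a₃ / 4 * √N) ≤ exp (-c N)` for
  every `z` of norm of order one (`exists_measureReal_mulVec_le_exp`). This survives the union bound
  for sparse vectors, those whose mass lies almost entirely on coordinates larger than
  `b = (κ N) ^ (-1 / 2)`. There are at most `κ N` such coordinates, so for `κ` small the net has
  `exp (c N / 2)` points (`exists_measureReal_sparseEvent_le`).
* At a small scale `ε = 1 / s`, a vector with mass bounded below on coordinates of size at most `b`
  has `P (‖Γ z‖ ≤ a₁ ε * √N) ≤ (C ε) ^ N` as long as `ε ^ 3 N ≥ 1`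
  (`exists_measureReal_mulVec_le_pow`). This needs mass on entries of variance at least `1` in
  every row, which the row condition provides if `a₄` is close to `1`: the other entries carry
  mass at most `(1 - a₄) n b ^ 2`. An `ε`-net has at most `(9 / ε) ^ n` points, so the union bound
  gives `C ^ N ε ^ (N - n)` (`exists_measureReal_spreadEvent_le`). The case is void unless `n` is
  proportional to `N`, and then `ε = exp (-D / δ)` makes this at most `exp (-N)`.

The lower bound on `δ` is what makes `ε ^ 3 N ≥ 1` compatible with this choice of `ε`, and it also
forces `N` to be large.
-/

/-! ### Characteristic functions and moments -/

theorem norm_exp_mul_I_sub_taylor_two_le (u : ℝ) {p : ℝ} (hp2 : 2 ≤ p) (hp3 : p ≤ 3) :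
    ‖Complex.exp (u * Complex.I) - 1 - u * Complex.I + (u : ℂ) ^ 2 / 2‖ ≤ 4 * |u| ^ p := by
  have hu0 : 0 ≤ |u| := abs_nonneg u
  rcases le_total |u| 1 with h | h
  · have h1 := Complex.norm_exp_sub_sum_le_norm_mul_exp (u * Complex.I) 3
    have h2 : Complex.exp (u * Complex.I) - 1 - u * Complex.I + (u : ℂ) ^ 2 / 2
        = Complex.exp (u * Complex.I) -
          ∑ m ∈ Finset.range 3, (u * Complex.I) ^ m / (m.factorial : ℂ) := by
      simp only [Finset.sum_range_succ, Finset.sum_range_zero, Nat.factorial]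
      push_cast
      ring_nf
      rw [Complex.I_sq]
      ring
    have h3 : ‖(u : ℂ) * Complex.I‖ = |u| := by simp
    rw [h2]
    refine h1.trans ?_
    rw [h3]
    have h4 : |u| ^ 3 ≤ |u| ^ p := by
      rcases hu0.eq_or_lt with h0 | h0
      · rw [← h0, Real.zero_rpow (by linarith)]; norm_num
      · rw [← Real.rpow_natCast]
        exact Real.rpow_le_rpow_of_exponent_ge h0 h (by exact_mod_cast hp3)
    have h5 : Real.exp |u| ≤ 4 :=
      (Real.exp_le_exp.2 h).trans (by linarith [Real.exp_one_lt_d9])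
    calc |u| ^ 3 * Real.exp |u| ≤ |u| ^ p * 4 := by gcongr
      _ = _ := by ring
  · have h1 : ‖Complex.exp (u * Complex.I)‖ = 1 := Complex.norm_exp_ofReal_mul_I u
    have h2 : |u| ^ 2 ≤ |u| ^ p := by
      rw [← Real.rpow_natCast]
      exact Real.rpow_le_rpow_of_exponent_le h (by exact_mod_cast hp2)
    have h3 : ‖(u : ℂ) * Complex.I‖ = |u| := by simp
    have h4 : ‖(u : ℂ) ^ 2 / 2‖ = |u| ^ 2 / 2 := by simp
    calc _ ≤ ‖Complex.exp (u * Complex.I)‖ + ‖(1 : ℂ)‖ + ‖(u : ℂ) * Complex.I‖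
          + ‖(u : ℂ) ^ 2 / 2‖ := by
            refine (norm_add_le _ _).trans ?_
            gcongr
            refine (norm_sub_le _ _).trans ?_
            gcongr
            exact norm_sub_le _ _
      _ = 1 + 1 + |u| + |u| ^ 2 / 2 := by rw [h1, h3, h4, norm_one]
      _ ≤ 4 * |u| ^ 2 := by nlinarith
      _ ≤ _ := by linarith

section Moments

variable {Ω : Type*} [MeasurableSpace Ω] {P : Measure Ω} [IsProbabilityMeasure P] {X : Ω → ℝ}

/-- Lyapunov's inequality for moments, from Bernoulli's inequality applied pointwise. -/
theorem moment_le_of_moment_le {p q m : ℝ} (hm : 0 < m) (hq : 0 < q) (hqp : q ≤ p)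
    (hX : Measurable X) (hint : Integrable (fun ω => |X ω| ^ p) P)
    (hle : ∫ ω, |X ω| ^ p ∂P ≤ m ^ p) :
    Integrable (fun ω => |X ω| ^ q) P ∧ ∫ ω, |X ω| ^ q ∂P ≤ m ^ q := by
  have hp : 0 < p := hq.trans_le hqp
  have hmp : 0 < m ^ p := Real.rpow_pos_of_pos hm p
  have hmq : 0 < m ^ q := Real.rpow_pos_of_pos hm q
  have key : ∀ ω, |X ω| ^ q ≤ m ^ q * (1 + q / p * (|X ω| ^ p / m ^ p - 1)) := by
    intro ω
    have h0 : 0 ≤ |X ω| / m := by positivity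
    have h1 := rpow_one_add_le_one_add_mul_self (s := (|X ω| / m) ^ p - 1)
      (by linarith [Real.rpow_nonneg h0 p]) (p := q / p) (by positivity)
      ((div_le_one hp).2 hqp)
    rw [add_sub_cancel, ← Real.rpow_mul h0, mul_div_cancel₀ _ hp.ne',
      Real.div_rpow (abs_nonneg _) hm.le, Real.div_rpow (abs_nonneg _) hm.le,
      div_le_iff₀ hmq] at h1
    linarith
  have hint2 : Integrable (fun ω => m ^ q * (1 + q / p * (|X ω| ^ p / m ^ p - 1))) P := by
    fun_prop
  have hintq : Integrable (fun ω => |X ω| ^ q) P := by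
    refine hint2.mono' (hX.abs.pow_const q).aestronglyMeasurable (ae_of_all _ fun ω => ?_)
    rw [Real.norm_of_nonneg (by positivity)]
    exact key ω
  refine ⟨hintq, (integral_mono hintq hint2 key).trans ?_⟩
  rw [integral_const_mul, integral_add (by fun_prop) (by fun_prop), integral_const_mul,
    integral_sub (by fun_prop) (by fun_prop), integral_div]
  simp only [integral_const, probReal_univ, one_smul]
  have h3 : (∫ ω, |X ω| ^ p ∂P) / m ^ p ≤ 1 := (div_le_one hmp).2 hle
  have h4 : q / p * ((∫ ω, |X ω| ^ p ∂P) / m ^ p - 1) ≤ 0 :=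
    mul_nonpos_of_nonneg_of_nonpos (by positivity) (by linarith)
  nlinarith

/-- The characteristic function of a centered variable decays like that of a Gaussian of the same
variance, up to an error given by a moment of order `p ∈ [2, 3]`. The bound holds for every `t`: it
exceeds `1` when `m * |t| ≥ 1`. -/
theorem norm_charFun_map_le_exp {p m : ℝ} (hm : 0 < m) (hp2 : 2 ≤ p) (hp3 : p ≤ 3)
    (hX : Measurable X) (hX1 : Integrable X P) (hX0 : ∫ ω, X ω ∂P = 0)
    (hint : Integrable (fun ω => |X ω| ^ p) P) (hle : ∫ ω, |X ω| ^ p ∂P ≤ m ^ p) (t : ℝ) :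
    ‖charFun (P.map X) t‖ ≤
      Real.exp (-(t ^ 2 / 2 * ∫ ω, X ω ^ 2 ∂P) + 4 * (m * |t|) ^ p) := by
  have h2 := moment_le_of_moment_le hm two_pos hp2 hX hint hle
  simp only [Real.rpow_two, sq_abs] at h2
  obtain ⟨hint2, hle2⟩ := h2
  set v := ∫ ω, X ω ^ 2 ∂P with hv
  have hv0 : 0 ≤ v := integral_nonneg fun ω => sq_nonneg _
  have hmt : 0 ≤ m * |t| := by positivity
  have hsq : t ^ 2 * v ≤ (m * |t|) ^ 2 := by
    rw [mul_pow, sq_abs, mul_comm]; gcongr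
  have : IsProbabilityMeasure (P.map X) := Measure.isProbabilityMeasure_map hX.aemeasurable
  rcases le_total (m * |t|) 1 with h | h
  · have htaylor : ‖charFun (P.map X) t - (1 - t ^ 2 / 2 * v : ℝ)‖ ≤ 4 * (m * |t|) ^ p := by
      have he : charFun (P.map X) t - (1 - t ^ 2 / 2 * v : ℝ) =
          ∫ ω, (Complex.exp ((t * X ω : ℝ) * Complex.I) - 1 - (t * X ω : ℝ) * Complex.I
            + ((t * X ω : ℝ) : ℂ) ^ 2 / 2) ∂P := by
        have i1 : Integrable (fun ω => Complex.exp ((t * X ω : ℝ) * Complex.I)) P := by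
          refine (integrable_const (1 : ℝ)).mono' (by fun_prop) (ae_of_all _ fun ω => ?_)
          rw [Complex.norm_exp_ofReal_mul_I]
        have i2 : Integrable (fun ω => ((t * X ω : ℝ) : ℂ) * Complex.I) P :=
          ((hX1.const_mul t).ofReal (𝕜 := ℂ)).mul_const _
        have i3 : Integrable (fun ω => ((t * X ω : ℝ) : ℂ) ^ 2 / 2) P := by
          have := ((hint2.const_mul (t ^ 2)).ofReal (𝕜 := ℂ)).div_const 2
          refine this.congr (ae_of_all _ fun ω => ?_)
          simp [mul_pow]
        have i4 : Integrable (fun ω => Complex.exp ((t * X ω : ℝ) * Complex.I) - 1) P :=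
          i1.sub (integrable_const 1)
        have i5 : Integrable (fun ω => Complex.exp ((t * X ω : ℝ) * Complex.I) - 1 -
            (t * X ω : ℝ) * Complex.I) P := i4.sub i2
        rw [integral_add i5 i3, integral_sub i4 i2, integral_sub i1 (integrable_const 1),
          charFun_apply_real, integral_map hX.aemeasurable (by fun_prop)]
        have e2 : ∫ ω, ((t * X ω : ℝ) : ℂ) * Complex.I ∂P = 0 := by
          rw [integral_mul_const, integral_complex_ofReal, integral_const_mul, hX0]; simp
        have e3 : ∫ ω, ((t * X ω : ℝ) : ℂ) ^ 2 / 2 ∂P = ((t ^ 2 / 2 * v : ℝ) : ℂ) := by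
          have : ∀ ω, ((t * X ω : ℝ) : ℂ) ^ 2 / 2 = ((t ^ 2 / 2 * X ω ^ 2 : ℝ) : ℂ) := by
            intro ω; push_cast; ring
          rw [integral_congr_ae (ae_of_all _ this), integral_complex_ofReal, integral_const_mul]
        rw [e2, e3]
        simp only [integral_const, probReal_univ, one_smul]
        push_cast
        ring
      rw [he]
      refine (norm_integral_le_integral_norm _).trans ?_
      calc _ ≤ ∫ ω, 4 * |t| ^ p * |X ω| ^ p ∂P := by
            refine integral_mono_of_nonneg (ae_of_all _ fun ω => norm_nonneg _)
              (hint.const_mul _) (ae_of_all _ fun ω => ?_)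
            refine (norm_exp_mul_I_sub_taylor_two_le (t * X ω) hp2 hp3).trans_eq ?_
            simp only [abs_mul]
            rw [Real.mul_rpow (abs_nonneg _) (abs_nonneg _), mul_assoc]
        _ ≤ 4 * |t| ^ p * m ^ p := by rw [integral_const_mul]; gcongr
        _ = _ := by rw [Real.mul_rpow hm.le (abs_nonneg _)]; ring
    have hsmall : 0 ≤ 1 - t ^ 2 / 2 * v := by nlinarith
    calc ‖charFun (P.map X) t‖
        ≤ ‖((1 - t ^ 2 / 2 * v : ℝ) : ℂ)‖ + ‖charFun (P.map X) t - (1 - t ^ 2 / 2 * v : ℝ)‖ :=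
          norm_le_norm_add_norm_sub' _ _
      _ ≤ (1 - t ^ 2 / 2 * v) + 4 * (m * |t|) ^ p := by
          gcongr
          rw [Complex.norm_real, Real.norm_of_nonneg hsmall]
      _ ≤ _ := by
          have := Real.add_one_le_exp (-(t ^ 2 / 2 * v) + 4 * (m * |t|) ^ p)
          linarith
  · refine (norm_charFun_le_one t).trans (Real.one_le_exp ?_)
    have : (m * |t|) ^ 2 ≤ (m * |t|) ^ p := by
      rw [← Real.rpow_two]
      exact Real.rpow_le_rpow_of_exponent_le h hp2
    nlinarith

end Moments

/-! ### Gaussian averages of characteristic functions -/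

section GaussianAverage

/-- Averaging the characteristic function of `ν` against a Gaussian bounds a Gaussian integral of
`ν`. -/
theorem integral_exp_neg_sq_le_integral_norm_charFun (ν : Measure ℝ) [IsProbabilityMeasure ν]
    (s : ℝ) :
    ∫ x, Real.exp (-(s * x) ^ 2 / 2) ∂ν ≤ ∫ g, ‖charFun ν (s * g)‖ ∂(gaussianReal 0 1) := by
  have h1 : ((∫ x, Real.exp (-(s * x) ^ 2 / 2) ∂ν : ℝ) : ℂ) =
      ∫ g, charFun ν (s * g) ∂(gaussianReal 0 1) := by
    rw [← integral_complex_ofReal]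
    have h2 : ∀ x : ℝ, ((Real.exp (-(s * x) ^ 2 / 2) : ℝ) : ℂ) =
        ∫ g : ℝ, Complex.exp ((s * x : ℝ) * g * Complex.I) ∂(gaussianReal 0 1) := by
      intro x
      rw [← charFun_apply_real, charFun_gaussianReal]
      push_cast
      congr 1
      simp
      ring
    simp_rw [h2]
    rw [integral_integral_swap]
    · simp_rw [charFun_apply_real]
      refine integral_congr_ae (ae_of_all _ fun g => integral_congr_ae (ae_of_all _ fun x => ?_))
      simp only
      congr 2
      push_cast
      ring
    · refine (integrable_const (1 : ℝ)).mono' ?_ (ae_of_all _ fun z => ?_)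
      · exact Measurable.aestronglyMeasurable (by unfold Function.uncurry; fun_prop)
      · have : ((s * z.1 : ℝ) : ℂ) * z.2 = ((s * z.1 * z.2 : ℝ) : ℂ) := by push_cast; rfl
        simp only [Function.uncurry]
        rw [this, Complex.norm_exp_ofReal_mul_I]
  calc _ ≤ ‖((∫ x, Real.exp (-(s * x) ^ 2 / 2) ∂ν : ℝ) : ℂ)‖ := by
        rw [Complex.norm_real]; exact le_abs_self _
    _ ≤ _ := by rw [h1]; exact norm_integral_le_integral_norm _

theorem integrable_pow_gaussianReal (k : ℕ) :
    Integrable (fun g : ℝ => g ^ k) (gaussianReal 0 1) := by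
  have := (memLp_id_gaussianReal (μ := 0) (v := 1) (k : NNReal)).integrable_norm_pow'
  refine this.mono (by fun_prop) (ae_of_all _ fun g => ?_)
  simp

theorem integral_sq_gaussianReal : ∫ g : ℝ, g ^ 2 ∂(gaussianReal 0 1) = 1 := by
  have h := variance_fun_id_gaussianReal (μ := 0) (v := 1)
  rw [variance_eq_integral (by fun_prop)] at h
  simpa using h

theorem integral_exp_neg_mul_sq_gaussianReal {A : ℝ} (hA : 0 ≤ A) :
    ∫ g : ℝ, Real.exp (-A * g ^ 2) ∂(gaussianReal 0 1) = (√(1 + 2 * A))⁻¹ := by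
  rw [integral_gaussianReal_eq_integral_smul one_ne_zero]
  have h : ∀ g : ℝ, gaussianPDFReal 0 1 g • Real.exp (-A * g ^ 2) =
      (√(2 * Real.pi))⁻¹ * Real.exp (-(A + 1 / 2) * g ^ 2) := by
    intro g
    rw [gaussianPDFReal, smul_eq_mul, mul_assoc, ← Real.exp_add]
    congr 2
    · simp
    · simp; ring
  simp_rw [h]
  rw [integral_const_mul, integral_gaussian, ← Real.sqrt_inv, ← Real.sqrt_mul (by positivity),
    ← Real.sqrt_inv]
  congr 1
  have := Real.pi_pos
  field_simp
  ring

/-- A small ball estimate: Gaussian decay of the characteristic function up to frequency `T` makes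
the Laplace transform of `x ^ 2` at scale `1 / s` of order `1 / (s * Y)`. -/
theorem integral_exp_neg_sq_le_of_charFun_decay (ν : Measure ℝ) [IsProbabilityMeasure ν]
    {s Y T : ℝ} (hs : 0 < s) (hY : 0 < Y) (hT : 0 < T)
    (hφ : ∀ t, |t| ≤ T → ‖charFun ν t‖ ≤ Real.exp (-(t ^ 2 * Y ^ 2 / 4))) :
    ∫ x, Real.exp (-(s * x) ^ 2 / 2) ∂ν ≤ 2 / (s * Y) + (s / T) ^ 2 := by
  have key : ∀ g : ℝ, ‖charFun ν (s * g)‖ ≤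
      Real.exp (-(s ^ 2 * Y ^ 2 / 4) * g ^ 2) + (s / T) ^ 2 * g ^ 2 := by
    intro g
    rcases le_total |s * g| T with h | h
    · refine (hφ _ h).trans ?_
      have : -((s * g) ^ 2 * Y ^ 2 / 4) = -(s ^ 2 * Y ^ 2 / 4) * g ^ 2 := by ring
      rw [this]
      have : 0 ≤ (s / T) ^ 2 * g ^ 2 := by positivity
      linarith
    · refine (norm_charFun_le_one _).trans ?_
      have h1 : 1 ≤ (s / T) ^ 2 * g ^ 2 := by
        have : (s / T) ^ 2 * g ^ 2 = (|s * g| / T) ^ 2 := by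
          rw [div_pow, div_pow, sq_abs]; ring
        rw [this]
        exact one_le_pow₀ ((one_le_div hT).2 h)
      linarith [Real.exp_pos (-(s ^ 2 * Y ^ 2 / 4) * g ^ 2)]
  have i1 : Integrable (fun g : ℝ => Real.exp (-(s ^ 2 * Y ^ 2 / 4) * g ^ 2))
      (gaussianReal 0 1) := by
    refine (integrable_const (1 : ℝ)).mono' (by fun_prop) (ae_of_all _ fun g => ?_)
    rw [Real.norm_of_nonneg (Real.exp_pos _).le, Real.exp_le_one_iff]
    have : 0 ≤ (s ^ 2 * Y ^ 2 / 4) * g ^ 2 := by positivity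
    linarith
  have i2 := (integrable_pow_gaussianReal 2).const_mul ((s / T) ^ 2)
  refine (integral_exp_neg_sq_le_integral_norm_charFun ν s).trans ?_
  refine (integral_mono_of_nonneg (ae_of_all _ fun g => norm_nonneg _) (i1.add i2)
    (ae_of_all _ key)).trans ?_
  simp only [Pi.add_apply]
  rw [integral_add i1 i2, integral_const_mul, integral_sq_gaussianReal,
    integral_exp_neg_mul_sq_gaussianReal (by positivity), mul_one, ← one_div]
  gcongr ?_ + _
  rw [div_le_div_iff₀ (by positivity) (by positivity), one_mul]
  have h2 : s * Y / 2 ≤ √(1 + 2 * (s ^ 2 * Y ^ 2 / 4)) := by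
    apply Real.le_sqrt_of_sq_le
    nlinarith [sq_nonneg (s * Y)]
  linarith

theorem min_one_exp_le {w u : ℝ} (hu : 0 ≤ u) (hw : -u ≤ w) :
    min 1 (Real.exp w) ≤ 1 + w + u ^ 2 := by
  rcases le_total 0 w with h | h
  · exact (min_le_left _ _).trans (by nlinarith)
  · refine (min_le_right _ _).trans ?_
    rcases le_total u 1 with h1 | h1
    · have := Real.abs_exp_sub_one_sub_id_le (x := w) (by rw [abs_le]; constructor <;> linarith)
      have := (abs_le.1 this).2
      nlinarith
    · have : Real.exp w ≤ 1 := Real.exp_le_one_iff.2 h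
      nlinarith

/-- The estimate at a constant scale: a lower bound `v` on the variance, seen in the
characteristic function near `0`, keeps the Laplace transform of `x ^ 2` below `1`. -/
theorem integral_exp_neg_sq_le_of_charFun_le (ν : Measure ℝ) [IsProbabilityMeasure ν]
    {s v V B p : ℝ} (hs : 0 < s) (hs1 : s ≤ 1) (hv : 0 ≤ v) (hvV : v ≤ V) (hB : 0 ≤ B)
    (hp2 : 2 ≤ p) (hp3 : p ≤ 3)
    (hφ : ∀ t, ‖charFun ν t‖ ≤ Real.exp (-(t ^ 2 / 2 * v) + B * |t| ^ p)) :
    ∫ x, Real.exp (-(s * x) ^ 2 / 2) ∂ν ≤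
      Real.exp (-(s ^ 2 / 2 * v) +
        (B + V ^ 2) * (∫ g : ℝ, (1 + g ^ 4) ∂(gaussianReal 0 1)) * s ^ p) := by
  have hsp : 0 < s ^ p := Real.rpow_pos_of_pos hs p
  have hs4 : s ^ 4 ≤ s ^ p := by
    rw [← Real.rpow_natCast]
    exact Real.rpow_le_rpow_of_exponent_ge hs hs1 (by push_cast; linarith)
  have hgp : ∀ g : ℝ, |g| ^ p ≤ 1 + g ^ 4 := by
    intro g
    have e : |g| ^ 4 = g ^ 4 := by rw [← abs_pow]; exact abs_of_nonneg (by positivity)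
    rcases le_total |g| 1 with h | h
    · have := Real.rpow_le_one (abs_nonneg g) h (by linarith : 0 ≤ p)
      nlinarith [sq_nonneg (g ^ 2)]
    · have : |g| ^ p ≤ |g| ^ ((4 : ℕ) : ℝ) :=
        Real.rpow_le_rpow_of_exponent_le h (by push_cast; linarith)
      rw [Real.rpow_natCast, e] at this
      linarith
  have key : ∀ g : ℝ, ‖charFun ν (s * g)‖ ≤
      (1 - s ^ 2 / 2 * v * g ^ 2) + ((B + V ^ 2) * s ^ p) * (1 + g ^ 4) := by
    intro g
    have h1 : ‖charFun ν (s * g)‖ ≤ min 1 (Real.exp (-((s * g) ^ 2 / 2 * v) + B * |s * g| ^ p)) :=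
      le_min (norm_charFun_le_one _) (hφ _)
    have h2 := min_one_exp_le (w := -((s * g) ^ 2 / 2 * v) + B * |s * g| ^ p)
      (u := (s * g) ^ 2 / 2 * v) (by positivity) (by
        have : 0 ≤ B * |s * g| ^ p := by positivity
        linarith)
    have h3 : B * |s * g| ^ p ≤ B * s ^ p * (1 + g ^ 4) := by
      rw [abs_mul, abs_of_pos hs, Real.mul_rpow hs.le (abs_nonneg _), mul_assoc]
      gcongr
      exact hgp g
    have h4 : ((s * g) ^ 2 / 2 * v) ^ 2 ≤ V ^ 2 * s ^ p * (1 + g ^ 4) := by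
      calc ((s * g) ^ 2 / 2 * v) ^ 2 = v ^ 2 * s ^ 4 * (g ^ 4 / 4) := by ring
        _ ≤ V ^ 2 * s ^ p * (1 + g ^ 4) := by
          gcongr
          nlinarith [sq_nonneg (g ^ 2)]
    calc _ ≤ _ := h1.trans h2
      _ ≤ _ := by nlinarith
  have i1 : Integrable (fun g : ℝ => 1 - s ^ 2 / 2 * v * g ^ 2) (gaussianReal 0 1) :=
    (integrable_const 1).sub ((integrable_pow_gaussianReal 2).const_mul _)
  have i2 : Integrable (fun g : ℝ => ((B + V ^ 2) * s ^ p) * (1 + g ^ 4)) (gaussianReal 0 1) :=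
    ((integrable_const 1).add (integrable_pow_gaussianReal 4)).const_mul _
  refine (integral_exp_neg_sq_le_integral_norm_charFun ν s).trans ?_
  refine (integral_mono_of_nonneg (ae_of_all _ fun g => norm_nonneg _) (i1.add i2)
    (ae_of_all _ key)).trans ?_
  simp only [Pi.add_apply]
  rw [integral_add i1 i2, integral_const_mul, integral_sub (integrable_const 1)
    ((integrable_pow_gaussianReal 2).const_mul _), integral_const_mul, integral_sq_gaussianReal]
  simp only [integral_const, probReal_univ, one_smul]
  refine le_trans (le_of_eq ?_) (Real.add_one_le_exp _)
  ring

end GaussianAverage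

/-! ### Independent rows -/

section Independence

variable {Ω : Type*} [MeasurableSpace Ω] {P : Measure Ω}

/-- A doubly indexed independent family is independent when grouped by its first index. -/
theorem iIndepFun_curry {ι κ 𝓧 : Type*} [MeasurableSpace 𝓧] {X : ι → κ → Ω → 𝓧}
    (mX : ∀ i j, Measurable (X i j)) (h : iIndepFun (fun (p : ι × κ) ω => X p.1 p.2 ω) P) :
    iIndepFun (fun i ω => (X i · ω)) P := by
  have := h.isProbabilityMeasure
  have hprob : ∀ i j, IsProbabilityMeasure (P.map (X i j)) :=
    fun i j => Measure.isProbabilityMeasure_map (mX i j).aemeasurable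
  have hrow : ∀ i, iIndepFun (X i) P := fun i =>
    h.precomp (g := fun j => (i, j)) fun _ _ h => (Prod.mk.inj h).2
  have hsigma : iIndepFun (fun (p : (_ : ι) × κ) ω => X p.1 p.2 ω) P :=
    h.precomp (Equiv.sigmaEquivProd ι κ).injective
  have hc : (MeasurableEquiv.piCurry fun (_ : ι) (_ : κ) => 𝓧) ∘ (fun ω p => X p.1 p.2 ω) =
      fun ω i j => X i j ω := by
    ext; simp [Sigma.curry]
  have hmeas : ∀ i, Measurable fun ω => (X i · ω) := fun i => by fun_prop
  rw [iIndepFun_iff_map_fun_eq_infinitePi_map (by fun_prop)]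
  have h2 := (iIndepFun_iff_map_fun_eq_infinitePi_map (by fun_prop)).1 hsigma
  rw [← hc, ← Measure.map_map (by fun_prop) (by fun_prop), h2,
    Measure.infinitePi_map_piCurry (fun i j => P.map (X i j))]
  congr 1
  ext1 i
  rw [(iIndepFun_iff_map_fun_eq_infinitePi_map (by fun_prop)).1 (hrow i)]

variable {N n : ℕ} {Γ : Ω → Matrix (Fin N) (Fin n) ℝ}

theorem HasIndepCenteredEntries.measurable_mulVec (hΓ : HasIndepCenteredEntries P Γ)
    (z : Fin n → ℝ) (j : Fin N) : Measurable fun ω => (Γ ω).mulVec z j := by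
  have := hΓ.measurable_entry
  simp only [Matrix.mulVec, dotProduct]
  fun_prop

/-- The Laplace transform of `‖Γ z‖ ^ 2` factors over the rows; by Markov's inequality so does the
bound on the probability that `‖Γ z‖ ^ 2` is small. -/
theorem HasIndepCenteredEntries.measureReal_sum_sq_le [IsProbabilityMeasure P]
    (hΓ : HasIndepCenteredEntries P Γ) (z : Fin n → ℝ) (s R : ℝ) (q : Fin N → ℝ)
    (hq : ∀ j, ∫ x, Real.exp (-(s * x) ^ 2 / 2) ∂(P.map fun ω => (Γ ω).mulVec z j) ≤ q j) :
    P.real {ω | ∑ j, (Γ ω).mulVec z j ^ 2 ≤ R} ≤ Real.exp (s ^ 2 * R / 2) * ∏ j, q j := by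
  have hm := hΓ.measurable_mulVec z
  have hind : iIndepFun (fun j ω => Γ ω j) P :=
    iIndepFun_curry (X := fun j i ω => Γ ω j i) hΓ.measurable_entry hΓ.indep
  have hrow : ∀ j, Measurable fun ω => Γ ω j := fun j =>
    measurable_pi_iff.2 fun i => hΓ.measurable_entry j i
  have hprod : ∫ ω, ∏ j, Real.exp (-(s * (Γ ω).mulVec z j) ^ 2 / 2) ∂P =
      ∏ j, ∫ ω, Real.exp (-(s * (Γ ω).mulVec z j) ^ 2 / 2) ∂P := by
    refine hind.integral_fun_prod_comp
      (f := fun _ x => Real.exp (-(s * dotProduct x z) ^ 2 / 2))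
      (fun j => (hrow j).aemeasurable) fun j => Measurable.aestronglyMeasurable ?_
    simp only [dotProduct]
    fun_prop
  have hle : ∏ j, ∫ ω, Real.exp (-(s * (Γ ω).mulVec z j) ^ 2 / 2) ∂P ≤ ∏ j, q j := by
    refine Finset.prod_le_prod (fun j _ => integral_nonneg fun ω => (Real.exp_pos _).le)
      fun j _ => ?_
    have := hq j
    rwa [integral_map (hm j).aemeasurable (by fun_prop)] at this
  have hint : Integrable (fun ω => ∏ j, Real.exp (-(s * (Γ ω).mulVec z j) ^ 2 / 2)) P := by
    refine (integrable_const (1 : ℝ)).mono' (Measurable.aestronglyMeasurable (by fun_prop))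
      (ae_of_all _ fun ω => ?_)
    rw [← Real.exp_sum, Real.norm_of_nonneg (Real.exp_pos _).le, Real.exp_le_one_iff]
    refine Finset.sum_nonpos fun j _ => ?_
    have := sq_nonneg (s * (Γ ω).mulVec z j)
    linarith
  have hmarkov := mul_meas_ge_le_integral_of_nonneg
    (ae_of_all _ fun ω => Finset.prod_nonneg fun j _ => (Real.exp_pos _).le) hint
    (Real.exp (-(s ^ 2 * R / 2)))
  have hsub : P.real {ω | ∑ j, (Γ ω).mulVec z j ^ 2 ≤ R} ≤
      P.real {ω | Real.exp (-(s ^ 2 * R / 2)) ≤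
        ∏ j, Real.exp (-(s * (Γ ω).mulVec z j) ^ 2 / 2)} := by
    refine measureReal_mono fun ω hω => ?_
    simp only [Set.mem_ofPred_eq] at hω ⊢
    rw [← Real.exp_sum, Real.exp_le_exp]
    have : ∑ j, -(s * (Γ ω).mulVec z j) ^ 2 / 2 =
        -(s ^ 2 * (∑ j, (Γ ω).mulVec z j ^ 2) / 2) := by
      rw [Finset.mul_sum, Finset.sum_div, ← Finset.sum_neg_distrib]
      exact Finset.sum_congr rfl fun j _ => by ring
    rw [this]
    gcongr
  calc _ ≤ _ := hsub
    _ = Real.exp (s ^ 2 * R / 2) * (Real.exp (-(s ^ 2 * R / 2)) *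
        P.real {ω | Real.exp (-(s ^ 2 * R / 2)) ≤
          ∏ j, Real.exp (-(s * (Γ ω).mulVec z j) ^ 2 / 2)}) := by
      rw [← mul_assoc, ← Real.exp_add, add_neg_cancel, Real.exp_zero, one_mul]
    _ ≤ _ := by
      gcongr
      exact hmarkov.trans (hprod.trans_le hle)

end Independence

/-! ### Estimates for a single vector -/

section SingleVector

variable {Ω : Type*} [MeasurableSpace Ω] {P : Measure Ω} [IsProbabilityMeasure P]
  {N n : ℕ} {Γ : Ω → Matrix (Fin N) (Fin n) ℝ} {p m : ℝ}

/-- In the bound on the characteristic function of a coordinate of `Γ z`, any set of coordinates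
of `z` may be dropped, because each factor has norm at most `1`. -/
theorem norm_charFun_mulVec_le (hm : 0 < m) (hp2 : 2 ≤ p) (hp3 : p ≤ 3)
    (hΓ : HasIndepCenteredEntries P Γ) (hmom : MomentCondition P Γ p m) (z : Fin n → ℝ)
    (j : Fin N) (I : Finset (Fin n)) (t : ℝ) :
    ‖charFun (P.map fun ω => (Γ ω).mulVec z j) t‖ ≤
      Real.exp (∑ i ∈ I, (-((t * z i) ^ 2 / 2 * ∫ ω, (Γ ω j i) ^ 2 ∂P)
        + 4 * (m * |t * z i|) ^ p)) := by
  have hme := hΓ.measurable_entry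
  have hind : iIndepFun (fun i ω => z i * Γ ω j i) P :=
    (hΓ.indep.precomp (g := fun i => (j, i)) fun _ _ h => (Prod.mk.inj h).2).comp
      (fun i x => z i * x) fun i => by fun_prop
  have hsum : (fun ω => (Γ ω).mulVec z j) = fun ω => ∑ i, z i * Γ ω j i := by
    ext ω
    simp only [Matrix.mulVec, dotProduct]
    exact Finset.sum_congr rfl fun i _ => mul_comm _ _
  have hfac : ∀ i, charFun (P.map fun ω => z i * Γ ω j i) t =
      charFun (P.map fun ω => Γ ω j i) (t * z i) := by
    intro i
    have h1 := hme j i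
    rw [charFun_apply_real, charFun_apply_real, integral_map (by fun_prop) (by fun_prop),
      integral_map (by fun_prop) (by fun_prop)]
    refine integral_congr_ae (ae_of_all _ fun ω => ?_)
    simp only
    congr 1
    push_cast
    ring
  rw [hsum, hind.charFun_map_fun_sum_eq_prod (fun i => by fun_prop), Finset.prod_apply, norm_prod,
    Real.exp_sum]
  simp_rw [hfac]
  have hpr : ∀ i, IsProbabilityMeasure (P.map fun ω => Γ ω j i) := fun i =>
    Measure.isProbabilityMeasure_map (hme j i).aemeasurable
  refine (Finset.prod_le_prod_of_subset_of_le_one (Finset.subset_univ I)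
    (fun i _ => norm_nonneg _) fun i _ _ => norm_charFun_le_one _).trans ?_
  exact Finset.prod_le_prod (fun i _ => norm_nonneg _) fun i _ =>
    norm_charFun_map_le_exp hm hp2 hp3 (hme j i) (hΓ.integrable_entry j i) (hΓ.centered j i)
      (hmom j i).1 (hmom j i).2 _

theorem exists_pos_mul_rpow_le {A B q : ℝ} (hA : 0 < A) (hB : 0 ≤ B) (hq : 0 < q) :
    ∃ s : ℝ, 0 < s ∧ s ≤ 1 ∧ B * s ^ q ≤ A := by
  refine ⟨min 1 ((A / (B + 1)) ^ (1 / q)), by positivity, min_le_left _ _, ?_⟩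
  have h1 : (min 1 ((A / (B + 1)) ^ (1 / q))) ^ q ≤ A / (B + 1) := by
    calc _ ≤ ((A / (B + 1)) ^ (1 / q)) ^ q :=
          Real.rpow_le_rpow (by positivity) (min_le_right _ _) hq.le
      _ = _ := by rw [← Real.rpow_mul (by positivity), one_div_mul_cancel hq.ne', Real.rpow_one]
  calc _ ≤ B * (A / (B + 1)) := by gcongr
    _ ≤ A := by
      rw [mul_div_assoc', div_le_iff₀ (by positivity)]
      nlinarith

end SingleVector

/-- For a fixed vector of norm between `1 / 2` and `1`, the column condition makes `‖Γ z‖` of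
order `√N` outside an event of exponentially small probability. -/
theorem exists_measureReal_mulVec_le_exp {p m a₃ : ℝ} (hm : 0 < m) (hp2 : 2 < p) (hp3 : p ≤ 3)
    (ha₃ : 0 < a₃) :
    ∃ c : ℝ, 0 < c ∧ ∀ {N n : ℕ} {Ω : Type*} [MeasurableSpace Ω] (P : Measure Ω)
      [IsProbabilityMeasure P] (Γ : Ω → Matrix (Fin N) (Fin n) ℝ),
      HasIndepCenteredEntries P Γ → MomentCondition P Γ p m → ColumnCondition P Γ a₃ →
      ∀ z : Fin n → ℝ, ∑ i, z i ^ 2 ≤ 1 → 1 / 4 ≤ ∑ i, z i ^ 2 →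
      P.real {ω | ∑ j, (Γ ω).mulVec z j ^ 2 ≤ (a₃ / 4) ^ 2 * N} ≤ Real.exp (-c * N) := by
  set K := (4 * m ^ p + (m ^ 2) ^ 2) * (∫ g : ℝ, (1 + g ^ 4) ∂(gaussianReal 0 1)) with hK
  have hM : 0 ≤ ∫ g : ℝ, (1 + g ^ 4) ∂(gaussianReal 0 1) :=
    integral_nonneg fun g => by positivity
  obtain ⟨s, hs, hs1, hsK⟩ := exists_pos_mul_rpow_le (A := a₃ ^ 2 / 32) (B := K) (q := p - 2)
    (by positivity) (by positivity) (by linarith)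
  refine ⟨s ^ 2 * a₃ ^ 2 / 16, by positivity, ?_⟩
  intro N n Ω _ P _ Γ hΓ hmom hcol z hz1 hz4
  have hvar : ∀ j i, ∫ ω, (Γ ω j i) ^ 2 ∂P ≤ m ^ 2 := by
    intro j i
    have h2 := (moment_le_of_moment_le hm two_pos hp2.le (hΓ.measurable_entry j i)
      (hmom j i).1 (hmom j i).2).2
    simpa only [Real.rpow_two, sq_abs] using h2
  have hvar0 : ∀ j i, 0 ≤ ∫ ω, (Γ ω j i) ^ 2 ∂P := fun j i =>
    integral_nonneg fun ω => sq_nonneg _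
  have hzabs : ∀ i, |z i| ≤ 1 := fun i => by
    rw [← sq_le_one_iff_abs_le_one]
    exact (Finset.single_le_sum (f := fun i => z i ^ 2) (fun i _ => sq_nonneg _)
      (Finset.mem_univ i)).trans hz1
  have hzp : ∑ i, |z i| ^ p ≤ 1 := by
    refine (Finset.sum_le_sum fun i _ => ?_).trans hz1
    have : |z i| ^ p ≤ |z i| ^ (2 : ℝ) :=
      Real.rpow_le_rpow_of_exponent_ge' (abs_nonneg _) (hzabs i) (by norm_num) hp2.le
    rwa [Real.rpow_two, sq_abs] at this
  have hrow := hΓ.measureReal_sum_sq_le z s ((a₃ / 4) ^ 2 * N)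
    (fun j => Real.exp (-(s ^ 2 / 2 * ∑ i, z i ^ 2 * ∫ ω, (Γ ω j i) ^ 2 ∂P) + K * s ^ p)) ?_
  · refine hrow.trans ?_
    rw [← Real.exp_sum, ← Real.exp_add, Real.exp_le_exp, Finset.sum_add_distrib]
    have h1 : a₃ ^ 2 * N / 4 ≤ ∑ j, ∑ i, z i ^ 2 * ∫ ω, (Γ ω j i) ^ 2 ∂P := by
      rw [Finset.sum_comm]
      calc a₃ ^ 2 * N / 4 ≤ (∑ i, z i ^ 2) * (a₃ ^ 2 * N) := by
            have : 0 ≤ a₃ ^ 2 * N := by positivity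
            nlinarith
        _ = ∑ i, z i ^ 2 * (a₃ ^ 2 * N) := by rw [Finset.sum_mul]
        _ ≤ _ := by
          refine Finset.sum_le_sum fun i _ => ?_
          rw [← Finset.mul_sum]
          exact mul_le_mul_of_nonneg_left (hcol i) (sq_nonneg _)
    have h2 : K * s ^ p ≤ s ^ 2 * (a₃ ^ 2 / 32) := by
      have : s ^ p = s ^ 2 * s ^ (p - 2) := by
        rw [← Real.rpow_two, ← Real.rpow_add hs]; ring_nf
      rw [this]
      have := mul_le_mul_of_nonneg_left hsK (sq_nonneg s)
      linarith
    simp only [Finset.sum_neg_distrib, Finset.sum_const, Finset.card_univ, Fintype.card_fin,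
      nsmul_eq_mul, ← Finset.mul_sum]
    have h3 := mul_le_mul_of_nonneg_left h1 (by positivity : 0 ≤ s ^ 2 / 2)
    have h4 := mul_le_mul_of_nonneg_left h2 (Nat.cast_nonneg N : (0 : ℝ) ≤ N)
    nlinarith
  · intro j
    have : IsProbabilityMeasure (P.map fun ω => (Γ ω).mulVec z j) :=
      Measure.isProbabilityMeasure_map (hΓ.measurable_mulVec z j).aemeasurable
    refine integral_exp_neg_sq_le_of_charFun_le _ hs hs1
      (Finset.sum_nonneg fun i _ => mul_nonneg (sq_nonneg _) (hvar0 j i)) (V := m ^ 2) ?_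
      (by positivity) hp2.le hp3 fun t => ?_
    · calc _ ≤ ∑ i, z i ^ 2 * m ^ 2 :=
            Finset.sum_le_sum fun i _ => mul_le_mul_of_nonneg_left (hvar j i) (sq_nonneg _)
        _ ≤ m ^ 2 := by
          rw [← Finset.sum_mul]
          nlinarith [sq_nonneg m]
    · refine (norm_charFun_mulVec_le hm hp2.le hp3 hΓ hmom z j Finset.univ t).trans ?_
      rw [Real.exp_le_exp, Finset.sum_add_distrib]
      have e1 : ∑ i, -((t * z i) ^ 2 / 2 * ∫ ω, (Γ ω j i) ^ 2 ∂P) =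
          -(t ^ 2 / 2 * ∑ i, z i ^ 2 * ∫ ω, (Γ ω j i) ^ 2 ∂P) := by
        rw [Finset.sum_neg_distrib, Finset.mul_sum]
        congr 1
        exact Finset.sum_congr rfl fun i _ => by ring
      have e2 : ∑ i, 4 * (m * |t * z i|) ^ p = 4 * m ^ p * |t| ^ p * ∑ i, |z i| ^ p := by
        rw [Finset.mul_sum]
        refine Finset.sum_congr rfl fun i _ => ?_
        rw [abs_mul, Real.mul_rpow hm.le (by positivity),
          Real.mul_rpow (abs_nonneg _) (abs_nonneg _)]
        ring
      rw [e1, e2]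
      have h0 : 0 ≤ 4 * m ^ p * |t| ^ p := by positivity
      have := mul_le_mul_of_nonneg_left hzp h0
      linarith

/-- For a fixed vector that has, in each row `j`, squared mass `Y ^ 2` on coordinates of absolute
value at most `b` that meet entries of variance at least `1`, the probability that
`‖Γ z‖ ^ 2 ≤ R`, with `R` of order `ε ^ 2 * N`, is at most the `N`-th power of a multiple of `ε`,
down to the scale where `(b / ε) ^ 2` stops being negligible against `ε`. -/
theorem exists_measureReal_mulVec_le_pow {p m : ℝ} (hm : 0 < m) (hp2 : 2 < p) (hp3 : p ≤ 3) :
    ∃ τ : ℝ, 0 < τ ∧ ∀ {N n : ℕ} {Ω : Type*} [MeasurableSpace Ω] (P : Measure Ω)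
      [IsProbabilityMeasure P] (Γ : Ω → Matrix (Fin N) (Fin n) ℝ),
      HasIndepCenteredEntries P Γ → MomentCondition P Γ p m →
      ∀ (z : Fin n → ℝ) (b Y ε R : ℝ) (I : Fin N → Finset (Fin n)), 0 < b → 0 < Y → 0 < ε →
      (∀ j, ∀ i ∈ I j, |z i| ≤ b ∧ 1 ≤ ∫ ω, (Γ ω j i) ^ 2 ∂P) →
      (∀ j, Y ^ 2 ≤ ∑ i ∈ I j, z i ^ 2) →
      P.real {ω | ∑ j, (Γ ω).mulVec z j ^ 2 ≤ R} ≤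
        Real.exp (R / (2 * ε ^ 2)) * (2 * ε / Y + (b / (ε * τ)) ^ 2) ^ N := by
  obtain ⟨τ, hτ, -, hτm⟩ := exists_pos_mul_rpow_le (A := 1 / 4) (B := 4 * m ^ p) (q := p - 2)
    (by positivity) (by positivity) (by linarith)
  refine ⟨τ, hτ, ?_⟩
  intro N n Ω _ P _ Γ hΓ hmom z b Y ε R I hb hY hε hI hYI
  have hrow := hΓ.measureReal_sum_sq_le z (1 / ε) R
    (fun j => 2 * ε / Y + (b / (ε * τ)) ^ 2) ?_
  · refine hrow.trans_eq ?_
    rw [Finset.prod_const, Finset.card_univ, Fintype.card_fin]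
    congr 2
    field_simp
  · intro j
    have : IsProbabilityMeasure (P.map fun ω => (Γ ω).mulVec z j) :=
      Measure.isProbabilityMeasure_map (hΓ.measurable_mulVec z j).aemeasurable
    have h := integral_exp_neg_sq_le_of_charFun_decay (P.map fun ω => (Γ ω).mulVec z j)
      (s := 1 / ε) (Y := Y) (T := τ / b) (by positivity) hY (by positivity) ?_
    · refine h.trans_eq ?_
      field_simp
    · intro t ht
      refine (norm_charFun_mulVec_le hm hp2.le hp3 hΓ hmom z j (I j) t).trans ?_
      rw [Real.exp_le_exp]
      calc _ ≤ ∑ i ∈ I j, -(t ^ 2 / 4 * z i ^ 2) := by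
            refine Finset.sum_le_sum fun i hi => ?_
            obtain ⟨hzb, hv⟩ := hI j i hi
            have htz : |t * z i| ≤ τ := by
              rw [abs_mul]
              calc |t| * |z i| ≤ τ / b * b := by gcongr
                _ = τ := div_mul_cancel₀ _ hb.ne'
            have hpow : 4 * (m * |t * z i|) ^ p ≤ 1 / 4 * (t * z i) ^ 2 := by
              have e : |t * z i| ^ p = |t * z i| ^ (p - 2) * (t * z i) ^ 2 := by
                rw [← sq_abs (t * z i), ← Real.rpow_two,
                  ← Real.rpow_add_of_nonneg (abs_nonneg _) (by linarith) (by norm_num)]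
                ring_nf
              rw [Real.mul_rpow hm.le (abs_nonneg _), e]
              have h1 : |t * z i| ^ (p - 2) ≤ τ ^ (p - 2) :=
                Real.rpow_le_rpow (abs_nonneg _) htz (by linarith)
              calc _ = (4 * m ^ p * |t * z i| ^ (p - 2)) * (t * z i) ^ 2 := by ring
                _ ≤ _ := by
                  gcongr
                  refine le_trans ?_ hτm
                  gcongr
            have h2 : (t * z i) ^ 2 / 2 * 1 ≤ (t * z i) ^ 2 / 2 * ∫ ω, (Γ ω j i) ^ 2 ∂P := by
              gcongr
            nlinarith
        _ = -(t ^ 2 / 4 * ∑ i ∈ I j, z i ^ 2) := by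
          rw [Finset.sum_neg_distrib, Finset.mul_sum]
        _ ≤ _ := by
          have := mul_le_mul_of_nonneg_left (hYI j) (by positivity : 0 ≤ t ^ 2 / 4)
          linarith

/-! ### Lattice approximation -/

section Lattice

theorem sum_Icc_exp_neg_mul_abs_le {t : ℝ} (ht : 0 < t) (M : ℕ) :
    ∑ a ∈ Finset.Icc (-(M : ℤ)) M, Real.exp (-t * |(a : ℝ)|) ≤
      1 + 2 / t * (1 - Real.exp (-t * M)) := by
  induction M with
  | zero => simp
  | succ M ih =>
    have hI : Finset.Icc (-((M + 1 : ℕ) : ℤ)) ((M + 1 : ℕ) : ℤ) =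
        insert (-((M : ℤ) + 1)) (insert ((M : ℤ) + 1) (Finset.Icc (-(M : ℤ)) M)) := by
      ext a
      simp only [Finset.mem_Icc, Finset.mem_insert]
      push_cast
      omega
    have habs : |(M : ℝ) + 1| = M + 1 := abs_of_nonneg (by positivity)
    have hneg : |((-((M : ℤ) + 1) : ℤ) : ℝ)| = M + 1 := by
      push_cast
      rw [abs_neg, habs]
    have hpos : |(((M : ℤ) + 1 : ℤ) : ℝ)| = M + 1 := by
      push_cast
      exact habs
    rw [hI, Finset.sum_insert, Finset.sum_insert, hneg, hpos]
    · have h1 : Real.exp (-t * M) = Real.exp t * Real.exp (-t * (M + 1)) := by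
        rw [← Real.exp_add]; congr 1; ring
      have h2 := Real.add_one_le_exp t
      have h3 := Real.exp_pos (-t * (M + 1))
      have h4 : 2 * Real.exp (-t * (M + 1)) ≤
          2 / t * (Real.exp (-t * M) - Real.exp (-t * (M + 1))) := by
        rw [h1, div_mul_eq_mul_div, le_div_iff₀ ht]
        nlinarith
      push_cast
      nlinarith
    · simp
    · simp only [Finset.mem_insert, Finset.mem_Icc, not_or]
      omega

/-- The integer points of the `ℓ₁`-ball of radius `M`. They are cut out of a box, so that the set is
visibly finite; the box condition follows from the other one. -/
noncomputable def latticeBall (n M : ℕ) : Finset (Fin n → ℤ) :=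
  (Fintype.piFinset fun _ => Finset.Icc (-(M : ℤ)) M).filter fun k => ∑ i, |k i| ≤ M

theorem mem_latticeBall_floor {n : ℕ} {L : ℝ} {k : Fin n → ℤ}
    (hk : ∑ i, |(k i : ℝ)| ≤ L) : k ∈ latticeBall n ⌊L⌋₊ := by
  have hsum : ∑ i, |k i| ≤ (⌊L⌋₊ : ℤ) := by
    have h0 : 0 ≤ ∑ i, |k i| := Finset.sum_nonneg fun i _ => abs_nonneg _
    have h1 : ((∑ i, |k i|).toNat : ℝ) ≤ L := by
      have : (((∑ i, |k i|).toNat : ℤ) : ℝ) = ∑ i, |(k i : ℝ)| := by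
        rw [Int.toNat_of_nonneg h0]; push_cast; rfl
      calc ((∑ i, |k i|).toNat : ℝ) = ∑ i, |(k i : ℝ)| := by exact_mod_cast this
        _ ≤ L := hk
    have h2 := Nat.le_floor h1
    omega
  refine Finset.mem_filter.2 ⟨Fintype.mem_piFinset.2 fun i => ?_, hsum⟩
  rw [Finset.mem_Icc, ← abs_le]
  exact (Finset.single_le_sum (f := fun i => |k i|) (fun i _ => abs_nonneg _)
    (Finset.mem_univ i)).trans hsum

/-- The exponential Chebyshev bound for the number of lattice points in an `ℓ₁`-ball. -/
theorem card_latticeBall_floor_le (n : ℕ) {L t : ℝ} (hL : 0 ≤ L) (ht : 0 < t) :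
    ((latticeBall n ⌊L⌋₊).card : ℝ) ≤ Real.exp (t * L) * (1 + 2 / t) ^ n := by
  set M := ⌊L⌋₊
  have hML : (M : ℝ) ≤ L := Nat.floor_le hL
  calc ((latticeBall n M).card : ℝ) = ∑ k ∈ latticeBall n M, (1 : ℝ) := by simp
    _ ≤ ∑ k ∈ latticeBall n M, Real.exp (t * L) * ∏ i, Real.exp (-t * |(k i : ℝ)|) := by
      refine Finset.sum_le_sum fun k hk => ?_
      rw [← Real.exp_sum, ← Real.exp_add, ← Finset.mul_sum]
      refine Real.one_le_exp ?_
      have h1 : ∑ i, |(k i : ℝ)| ≤ M := by exact_mod_cast (Finset.mem_filter.1 hk).2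
      nlinarith
    _ ≤ ∑ k ∈ Fintype.piFinset fun _ : Fin n => Finset.Icc (-(M : ℤ)) M,
        Real.exp (t * L) * ∏ i, Real.exp (-t * |(k i : ℝ)|) :=
      Finset.sum_le_sum_of_subset_of_nonneg (Finset.filter_subset _ _) fun _ _ _ => by positivity
    _ = Real.exp (t * L) * ∏ _i : Fin n, ∑ a ∈ Finset.Icc (-(M : ℤ)) M,
        Real.exp (-t * |(a : ℝ)|) := by
      rw [← Finset.mul_sum, Finset.prod_univ_sum]
    _ ≤ _ := by
      rw [Finset.prod_const, Finset.card_univ, Fintype.card_fin]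
      have := sum_Icc_exp_neg_mul_abs_le ht M
      have h1 : 0 ≤ 2 / t * Real.exp (-t * M) := by positivity
      gcongr
      linarith

theorem exists_int_mul_abs_sub_le {h : ℝ} (hh : 0 < h) (x : ℝ) :
    ∃ k : ℤ, h * |(k : ℝ)| ≤ |x| ∧ |x - h * k| ≤ h := by
  have key : ∀ y : ℝ, 0 ≤ y → ∃ k : ℤ, h * |(k : ℝ)| ≤ |y| ∧ |y - h * k| ≤ h := by
    intro y hy
    have h1 := Int.floor_le (y / h)
    have h2 := Int.lt_floor_add_one (y / h)
    have h0 : (0 : ℝ) ≤ ⌊y / h⌋ := by exact_mod_cast Int.floor_nonneg.2 (by positivity)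
    rw [le_div_iff₀ hh] at h1
    rw [div_lt_iff₀ hh] at h2
    refine ⟨⌊y / h⌋, ?_, ?_⟩
    · rw [abs_of_nonneg h0, abs_of_nonneg hy]; linarith
    · rw [abs_le]; constructor <;> linarith
  rcases le_total 0 x with hx | hx
  · exact key x hx
  · obtain ⟨k, h1, h2⟩ := key (-x) (by linarith)
    refine ⟨-k, by simpa using h1, ?_⟩
    rw [← abs_neg]
    push_cast
    convert h2 using 2
    ring

/-- Approximation of a vector with little mass on its small coordinates: those are discarded, and
the large ones, of which there are at most `1 / b ^ 2`, are rounded to multiples of `η * b`. -/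
theorem exists_lattice_approx_of_sparse {n : ℕ} {x : Fin n → ℝ} {b η : ℝ} (hb : 0 < b)
    (hη : 0 < η) (hx : ∑ i, x i ^ 2 = 1)
    (hsmall : ∑ i with |x i| ≤ b, x i ^ 2 ≤ η ^ 2) :
    ∃ k ∈ latticeBall n ⌊1 / (η * b ^ 2)⌋₊, (∑ i, (η * b * k i) ^ 2 ≤ 1) ∧
      ∑ i, (x i - η * b * k i) ^ 2 ≤ 2 * η ^ 2 := by
  choose k₀ hk₀ hk₀' using fun i => exists_int_mul_abs_sub_le (mul_pos hη hb) (x i)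
  set k : Fin n → ℤ := fun i => if |x i| ≤ b then 0 else k₀ i with hk
  have hle : ∀ i, η * b * |(k i : ℝ)| ≤ |x i| := by
    intro i
    simp only [hk]
    split_ifs
    · simp
    · exact hk₀ i
  refine ⟨k, mem_latticeBall_floor ?_, ?_, ?_⟩
  · rw [le_div_iff₀ (by positivity), Finset.sum_mul, ← hx]
    refine Finset.sum_le_sum fun i _ => ?_
    simp only [hk]
    split_ifs with h
    · simpa using sq_nonneg (x i)
    · have h1 := hk₀ i
      calc |(k₀ i : ℝ)| * (η * b ^ 2) = (η * b * |(k₀ i : ℝ)|) * b := by ring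
        _ ≤ |x i| * |x i| := by
          gcongr
          exact (not_le.1 h).le
        _ = x i ^ 2 := by rw [← sq, sq_abs]
  · rw [← hx]
    refine Finset.sum_le_sum fun i _ => ?_
    rw [sq_le_sq, abs_mul, abs_of_pos (mul_pos hη hb)]
    exact hle i
  · rw [← Finset.sum_filter_add_sum_filter_not Finset.univ (fun i => |x i| ≤ b)]
    have e1 : ∑ i with |x i| ≤ b, (x i - η * b * k i) ^ 2 = ∑ i with |x i| ≤ b, x i ^ 2 := by
      refine Finset.sum_congr rfl fun i hi => ?_
      simp [hk, (Finset.mem_filter.1 hi).2]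
    have e2 : ∑ i with ¬ |x i| ≤ b, (x i - η * b * k i) ^ 2 ≤ η ^ 2 := by
      calc _ ≤ ∑ i with ¬ |x i| ≤ b, η ^ 2 * x i ^ 2 := by
            refine Finset.sum_le_sum fun i hi => ?_
            have h := (Finset.mem_filter.1 hi).2
            simp only [hk, if_neg h]
            rw [← mul_pow, sq_le_sq, abs_mul, abs_of_pos hη]
            refine (hk₀' i).trans ?_
            gcongr
            exact (not_le.1 h).le
        _ ≤ ∑ i, η ^ 2 * x i ^ 2 :=
            Finset.sum_le_sum_of_subset_of_nonneg (Finset.filter_subset _ _) fun _ _ _ => by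
              positivity
        _ = η ^ 2 := by rw [← Finset.mul_sum, hx, mul_one]
    linarith

/-- Rounding towards `0` to multiples of `ε / √n`: no coordinate grows, so a spread vector stays
spread. -/
theorem exists_lattice_approx {n : ℕ} (hn : 0 < n) {x : Fin n → ℝ} {ε : ℝ} (hε : 0 < ε)
    (hx : ∑ i, x i ^ 2 = 1) :
    ∃ k ∈ latticeBall n ⌊n / ε⌋₊, (∀ i, |ε / √n * k i| ≤ |x i|) ∧
      ∑ i, (x i - ε / √n * k i) ^ 2 ≤ ε ^ 2 := by
  have hn' : (0 : ℝ) < n := by exact_mod_cast hn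
  have hs : 0 < √(n : ℝ) := Real.sqrt_pos.2 hn'
  have hsn : √(n : ℝ) ^ 2 = n := Real.sq_sqrt hn'.le
  have hh : 0 < ε / √n := by positivity
  choose k hk hk' using fun i => exists_int_mul_abs_sub_le hh (x i)
  refine ⟨k, mem_latticeBall_floor ?_, fun i => ?_, ?_⟩
  · have h1 : ∑ i, |x i| ≤ √n := by
      refine Real.le_sqrt_of_sq_le ?_
      have := sq_sum_le_card_mul_sum_sq (s := Finset.univ) (f := fun i => |x i|)
      simpa [hx] using this
    have h2 : ε / √n * ∑ i, |(k i : ℝ)| ≤ √n := by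
      rw [Finset.mul_sum]
      exact (Finset.sum_le_sum fun i _ => hk i).trans h1
    rw [le_div_iff₀ hε]
    rw [div_mul_eq_mul_div, div_le_iff₀ hs] at h2
    nlinarith
  · rw [abs_mul, abs_of_pos hh]
    exact hk i
  · calc _ ≤ ∑ _i : Fin n, (ε / √n) ^ 2 := by
          refine Finset.sum_le_sum fun i _ => ?_
          rw [sq_le_sq, abs_of_pos hh]
          exact hk' i
      _ = ε ^ 2 := by
        rw [Finset.sum_const, Finset.card_univ, Fintype.card_fin, nsmul_eq_mul, div_pow, hsn]
        field_simp

end Lattice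

/-! ### Singular values and the operator norm -/

section Deterministic

variable {N n : ℕ}

theorem sum_mulVec_sq_le (A : Matrix (Fin N) (Fin n) ℝ) (u : Fin n → ℝ) :
    ∑ j, A.mulVec u j ^ 2 ≤ spectralNorm2 A ^ 2 * ∑ i, u i ^ 2 := by
  have h := (LinearMap.toContinuousLinearMap (Matrix.toEuclideanLin A)).le_opNorm
    (WithLp.toLp 2 u)
  have h2 := pow_le_pow_left₀ (norm_nonneg _) h 2
  rw [mul_pow, EuclideanSpace.norm_sq_eq, EuclideanSpace.norm_sq_eq] at h2
  simpa [spectralNorm2, Matrix.toLpLin_apply] using h2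

/-- A unit eigenvector of `Aᵗ A` witnesses the smallest singular value. -/
theorem exists_sum_mulVec_sq_le_of_smallestSingularValue_le (hn : 1 ≤ n)
    (A : Matrix (Fin N) (Fin n) ℝ) {c : ℝ} (hA : smallestSingularValue A ≤ c) :
    ∃ x : Fin n → ℝ, ∑ i, x i ^ 2 = 1 ∧ ∑ j, A.mulVec x j ^ 2 ≤ c ^ 2 := by
  set T := Matrix.toEuclideanLin A with hT
  have hlt : n - 1 < Module.finrank ℝ (EuclideanSpace ℝ (Fin n)) := by
    simp; omega
  obtain ⟨v, hv⟩ := (T.hasEigenvalue_adjoint_comp_self_sq_singularValues hlt).exists_hasEigenvector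
  have hv0 : 0 < ‖v‖ := norm_pos_iff.2 hv.2
  have hTv : ‖T v‖ ^ 2 = T.singularValues (n - 1) ^ 2 * ‖v‖ ^ 2 := by
    have h1 := hv.apply_eq_smul
    have h2 : inner ℝ ((LinearMap.adjoint T ∘ₗ T) v) v = inner ℝ (T v) (T v) := by
      rw [LinearMap.comp_apply, LinearMap.adjoint_inner_left]
    rw [h1, inner_smul_left] at h2
    simpa using h2.symm
  refine ⟨fun i => ‖v‖⁻¹ * v i, ?_, ?_⟩
  · have h1 : ∑ i, v i ^ 2 = ‖v‖ ^ 2 := by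
      rw [EuclideanSpace.norm_sq_eq]; simp
    simp_rw [mul_pow]
    rw [← Finset.mul_sum, h1]
    field_simp
  · have h1 : ∑ j, A.mulVec (fun i => v i) j ^ 2 = ‖T v‖ ^ 2 := by
      rw [EuclideanSpace.norm_sq_eq]; simp [hT, Matrix.toLpLin_apply]
    have h2 : A.mulVec (fun i => ‖v‖⁻¹ * v i) = ‖v‖⁻¹ • A.mulVec (fun i => v i) := by
      rw [← Matrix.mulVec_smul]; rfl
    simp only [h2, Pi.smul_apply, smul_eq_mul, mul_pow]
    rw [← Finset.mul_sum, h1, hTv]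
    have h3 : (‖v‖⁻¹) ^ 2 * (T.singularValues (n - 1) ^ 2 * ‖v‖ ^ 2) =
        T.singularValues (n - 1) ^ 2 := by field_simp
    rw [h3]
    exact pow_le_pow_left₀ (T.singularValues_nonneg _) hA 2

/-- A vector close to one with a small image has itself a small image. -/
theorem sum_mulVec_sq_le_of_approx (A : Matrix (Fin N) (Fin n) ℝ) {x z : Fin n → ℝ} {a d e : ℝ}
    (hA : spectralNorm2 A ≤ a) (hx : ∑ j, A.mulVec x j ^ 2 ≤ d)
    (hxz : ∑ i, (x i - z i) ^ 2 ≤ e) :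
    ∑ j, A.mulVec z j ^ 2 ≤ 2 * d + 2 * (a ^ 2 * e) := by
  have h1 := sum_mulVec_sq_le A (x - z)
  have h2 : spectralNorm2 A ^ 2 * ∑ i, (x - z) i ^ 2 ≤ a ^ 2 * e := by
    have h0 : 0 ≤ spectralNorm2 A := norm_nonneg _
    have h3 : 0 ≤ ∑ i, (x i - z i) ^ 2 := Finset.sum_nonneg fun i _ => sq_nonneg _
    simp only [Pi.sub_apply]
    gcongr
  have h4 : ∑ j, A.mulVec z j ^ 2 ≤
      ∑ j, (2 * A.mulVec x j ^ 2 + 2 * A.mulVec (x - z) j ^ 2) := by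
    refine Finset.sum_le_sum fun j _ => ?_
    rw [Matrix.mulVec_sub, Pi.sub_apply]
    nlinarith [sq_nonneg (2 * A.mulVec x j - A.mulVec z j)]
  rw [Finset.sum_add_distrib, ← Finset.mul_sum, ← Finset.mul_sum] at h4
  linarith

end Deterministic

/-! ### Union bounds over nets -/

section Nets

/-- The event that `Γ` has norm at most `a₁ * √N` and yet maps to norm at most `ρ * √N` a unit
vector all but `η ^ 2` of whose mass lies on coordinates larger than `b`. -/
def sparseEvent {Ω : Type*} {N n : ℕ} (Γ : Ω → Matrix (Fin N) (Fin n) ℝ)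
    (a₁ b η ρ : ℝ) : Set Ω :=
  {ω | spectralNorm2 (Γ ω) ≤ a₁ * √(N : ℝ) ∧ ∃ x : Fin n → ℝ, ∑ i, x i ^ 2 = 1 ∧
    ∑ i with |x i| ≤ b, x i ^ 2 ≤ η ^ 2 ∧ ∑ j, (Γ ω).mulVec x j ^ 2 ≤ ρ ^ 2 * N}

/-- The event that `Γ` has norm at most `a₁ * √N` and yet maps to norm at most `ρ * √N` a unit
vector with mass more than `η ^ 2` on coordinates of absolute value at most `b`. -/
def spreadEvent {Ω : Type*} {N n : ℕ} (Γ : Ω → Matrix (Fin N) (Fin n) ℝ)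
    (a₁ b η ρ : ℝ) : Set Ω :=
  {ω | spectralNorm2 (Γ ω) ≤ a₁ * √(N : ℝ) ∧ ∃ x : Fin n → ℝ, ∑ i, x i ^ 2 = 1 ∧
    η ^ 2 < ∑ i with |x i| ≤ b, x i ^ 2 ∧ ∑ j, (Γ ω).mulVec x j ^ 2 ≤ ρ ^ 2 * N}

theorem sum_sq_le_two_mul_add {ι : Type*} (I : Finset ι) (x z : ι → ℝ) :
    ∑ i ∈ I, x i ^ 2 ≤ 2 * ∑ i ∈ I, z i ^ 2 + 2 * ∑ i ∈ I, (x i - z i) ^ 2 := by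
  rw [Finset.mul_sum, Finset.mul_sum, ← Finset.sum_add_distrib]
  refine Finset.sum_le_sum fun i _ => ?_
  nlinarith [sq_nonneg (x i - 2 * z i)]

/-- Nearly sparse vectors, with at most about `κ * N` large coordinates, form a set of so small a
complexity that the estimate for a single vector survives the union bound over a net. -/
theorem exists_measureReal_sparseEvent_le {p m a₁ a₃ η : ℝ} (hm : 0 < m) (hp2 : 2 < p)
    (hp3 : p ≤ 3) (ha₁ : 0 < a₁) (ha₃ : 0 < a₃) (hη : 0 < η) (hη4 : η ≤ 1 / 4)
    (hηa : 12 * a₁ * η ≤ a₃) :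
    ∃ c κ : ℝ, 0 < c ∧ 0 < κ ∧ ∀ {N n : ℕ} {Ω : Type*} [MeasurableSpace Ω] (P : Measure Ω)
      [IsProbabilityMeasure P] (Γ : Ω → Matrix (Fin N) (Fin n) ℝ), 1 ≤ n → n ≤ N →
      HasIndepCenteredEntries P Γ → MomentCondition P Γ p m → ColumnCondition P Γ a₃ →
      P.real (sparseEvent Γ a₁ (1 / √(κ * N)) η (a₃ / 8)) ≤ Real.exp (-c * N) := by
  obtain ⟨c, hc, hsingle⟩ := exists_measureReal_mulVec_le_exp hm hp2 hp3 ha₃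
  -- with this `κ`, the net has at most `exp (c * N / 2)` points: the parameter `8 / c` in
  -- `card_latticeBall_floor_le` contributes `exp (c * N / 4)` to each of the two factors
  refine ⟨c / 2, η * c ^ 2 / 32, by positivity, by positivity, ?_⟩
  intro N n Ω _ P _ Γ hn hnN hΓ hmom hcol
  set κ := η * c ^ 2 / 32 with hκ
  have hN : (0 : ℝ) < N := by exact_mod_cast (by omega : 0 < N)
  have hκ0 : 0 < κ := by positivity
  set b := 1 / √(κ * N) with hb
  have hb0 : 0 < b := by positivity
  have hbsq : b ^ 2 = 1 / (κ * N) := by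
    rw [hb, div_pow, Real.sq_sqrt (by positivity), one_pow]
  have hL : 1 / (η * b ^ 2) = c ^ 2 / 32 * N := by
    rw [hbsq, hκ]; field_simp
  classical
  set net := (latticeBall n ⌊1 / (η * b ^ 2)⌋₊).filter fun k =>
    ∑ i, (η * b * k i) ^ 2 ≤ 1 ∧ 1 / 4 ≤ ∑ i, (η * b * k i) ^ 2
  have hsub : sparseEvent Γ a₁ b η (a₃ / 8) ⊆ ⋃ k ∈ net,
      {ω | ∑ j, (Γ ω).mulVec (fun i => η * b * k i) j ^ 2 ≤ (a₃ / 4) ^ 2 * N} := by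
    rintro ω ⟨hA, x, hx, hsmall, hΓx⟩
    obtain ⟨k, hk, hk1, hkx⟩ := exists_lattice_approx_of_sparse hb0 hη hx hsmall
    simp only [Set.mem_iUnion]
    refine ⟨k, Finset.mem_filter.2 ⟨hk, hk1, ?_⟩, ?_⟩
    · have := sum_sq_le_two_mul_add Finset.univ x fun i => η * b * k i
      nlinarith
    · refine (sum_mulVec_sq_le_of_approx _ hA hΓx hkx).trans ?_
      rw [mul_pow, Real.sq_sqrt hN.le]
      have h1 : (12 * a₁ * η) ^ 2 ≤ a₃ ^ 2 := by gcongr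
      nlinarith
  have hcard : (net.card : ℝ) ≤ Real.exp (c / 2 * N) := by
    have h1 := card_latticeBall_floor_le n (L := c ^ 2 / 32 * N) (t := 8 / c)
      (by positivity) (by positivity)
    have h2 : (net.card : ℝ) ≤ (latticeBall n ⌊1 / (η * b ^ 2)⌋₊).card := by
      exact_mod_cast Finset.card_filter_le _ _
    rw [hL] at h2
    refine h2.trans (h1.trans ?_)
    have h3 : (1 + 2 / (8 / c)) ^ n ≤ Real.exp (c / 4 * N) := by
      calc (1 + 2 / (8 / c)) ^ n = (c / 4 + 1) ^ n := by congr 1; field_simp; ring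
        _ ≤ Real.exp (c / 4) ^ n := by gcongr; exact Real.add_one_le_exp _
        _ = Real.exp (c / 4 * n) := by rw [← Real.exp_nat_mul]; congr 1; ring
        _ ≤ _ := by gcongr
    calc _ ≤ Real.exp (8 / c * (c ^ 2 / 32 * N)) * Real.exp (c / 4 * N) := by gcongr
      _ = _ := by
        rw [← Real.exp_add]
        congr 1
        field_simp
        ring
  calc _ ≤ P.real (⋃ k ∈ net, {ω | ∑ j, (Γ ω).mulVec (fun i => η * b * k i) j ^ 2 ≤
        (a₃ / 4) ^ 2 * N}) := measureReal_mono hsub (measure_ne_top _ _)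
    _ ≤ ∑ k ∈ net, P.real {ω | ∑ j, (Γ ω).mulVec (fun i => η * b * k i) j ^ 2 ≤
        (a₃ / 4) ^ 2 * N} := measureReal_biUnion_finset_le _ _
    _ ≤ ∑ _k ∈ net, Real.exp (-c * N) := Finset.sum_le_sum fun k hk =>
        hsingle P Γ hΓ hmom hcol _ (Finset.mem_filter.1 hk).2.1 (Finset.mem_filter.1 hk).2.2
    _ = net.card * Real.exp (-c * N) := by rw [Finset.sum_const, nsmul_eq_mul]
    _ ≤ Real.exp (c / 2 * N) * Real.exp (-c * N) := by gcongr
    _ = _ := by rw [← Real.exp_add]; congr 1; ring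

/-- In each row, the mass on small coordinates is carried mostly by the entries of variance at
least `1`: the other entries are too few. -/
theorem sum_filter_le_of_rowCondition {Ω : Type*} [MeasurableSpace Ω] {P : Measure Ω} {N n : ℕ}
    {Γ : Ω → Matrix (Fin N) (Fin n) ℝ} {a₄ γ b : ℝ} (hrow : RowCondition P Γ a₄)
    (hγ : 1 - γ < a₄) (x : Fin n → ℝ) (j : Fin N) [DecidablePred fun i => |x i| ≤ b]
    [DecidablePred fun i => 1 ≤ ∫ ω, (Γ ω j i) ^ 2 ∂P] :
    ∑ i with |x i| ≤ b, x i ^ 2 ≤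
      ∑ i with |x i| ≤ b ∧ 1 ≤ ∫ ω, (Γ ω j i) ^ 2 ∂P, x i ^ 2 + γ * n * b ^ 2 := by
  have hcard : (((Finset.univ.filter fun i => ¬ 1 ≤ ∫ ω, (Γ ω j i) ^ 2 ∂P).card : ℕ) : ℝ) ≤
      γ * n := by
    have h1 := hrow j
    rw [Set.ncard_eq_toFinset_card', Set.toFinset_ofPred] at h1
    have h2 := Finset.card_filter_add_card_filter_not (s := (Finset.univ : Finset (Fin n)))
      (fun i => 1 ≤ ∫ ω, (Γ ω j i) ^ 2 ∂P)
    rw [Finset.card_univ, Fintype.card_fin] at h2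
    have h3 : (((Finset.univ.filter fun i => 1 ≤ ∫ ω, (Γ ω j i) ^ 2 ∂P).card : ℕ) : ℝ) +
      ((Finset.univ.filter fun i => ¬ 1 ≤ ∫ ω, (Γ ω j i) ^ 2 ∂P).card : ℕ) = n := by
        exact_mod_cast h2
    have h4 : (0 : ℝ) ≤ n := Nat.cast_nonneg n
    nlinarith
  rw [← Finset.sum_filter_add_sum_filter_not (Finset.univ.filter fun i => |x i| ≤ b)
    (fun i => 1 ≤ ∫ ω, (Γ ω j i) ^ 2 ∂P), Finset.filter_filter, Finset.filter_filter]
  gcongr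
  calc _ ≤ ∑ i with |x i| ≤ b ∧ ¬ 1 ≤ ∫ ω, (Γ ω j i) ^ 2 ∂P, b ^ 2 := by
        refine Finset.sum_le_sum fun i hi => ?_
        rw [← sq_abs]
        exact pow_le_pow_left₀ (abs_nonneg _) (Finset.mem_filter.1 hi).2.1 2
    _ ≤ ∑ i with ¬ 1 ≤ ∫ ω, (Γ ω j i) ^ 2 ∂P, b ^ 2 := by
        refine Finset.sum_le_sum_of_subset_of_nonneg (fun i hi => ?_) fun _ _ _ => sq_nonneg b
        simp only [Finset.mem_filter, Finset.mem_univ, true_and] at hi ⊢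
        exact hi.2
    _ ≤ _ := by
        rw [Finset.sum_const, nsmul_eq_mul]
        gcongr

/-- The union bound over an `ε`-net of the spread vectors: the `N`-th power of `ε` from the small
ball estimate outweighs the `n`-th power of `1 / ε` from the size of the net. -/
theorem exists_measureReal_spreadEvent_le {p m a₁ η κ : ℝ} (hm : 0 < m) (hp2 : 2 < p)
    (hp3 : p ≤ 3) (hη : 0 < η) (hκ : 0 < κ) :
    ∃ C : ℝ, 1 ≤ C ∧ ∀ {N n : ℕ} {Ω : Type*} [MeasurableSpace Ω] (P : Measure Ω)
      [IsProbabilityMeasure P] (Γ : Ω → Matrix (Fin N) (Fin n) ℝ) (a₄ ε : ℝ), 1 ≤ n → n ≤ N →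
      HasIndepCenteredEntries P Γ → MomentCondition P Γ p m → RowCondition P Γ a₄ →
      1 - κ * η ^ 2 / 4 < a₄ → 0 < ε → ε ≤ 1 → ε ≤ η / 3 → 1 ≤ ε ^ 3 * N →
      P.real (spreadEvent Γ a₁ (1 / √(κ * N)) η (a₁ * ε)) ≤ C ^ N * ε ^ (N - n) := by
  obtain ⟨τ, hτ, hsingle⟩ := exists_measureReal_mulVec_le_pow hm hp2 hp3
  set C₀ := Real.exp (2 * a₁ ^ 2) * (4 / η + 1 / (κ * τ ^ 2)) with hC₀
  have hC₀' : 0 < C₀ := by positivity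
  refine ⟨max 1 (9 * C₀), le_max_left _ _, ?_⟩
  intro N n Ω _ P _ Γ a₄ ε hn hnN hΓ hmom hrow ha₄ hε hε1 hεη hεN
  have hN : (0 : ℝ) < N := by exact_mod_cast (by omega : 0 < N)
  have hnN' : (n : ℝ) ≤ N := by exact_mod_cast hnN
  set b := 1 / √(κ * N) with hb
  have hb0 : 0 < b := by positivity
  have hbsq : b ^ 2 = 1 / (κ * N) := by
    rw [hb, div_pow, Real.sq_sqrt (by positivity), one_pow]
  classical
  set h := ε / √(n : ℝ) with hh
  set I : (Fin n → ℤ) → Fin N → Finset (Fin n) := fun k j =>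
    Finset.univ.filter fun i => |h * k i| ≤ b ∧ 1 ≤ ∫ ω, (Γ ω j i) ^ 2 ∂P with hI
  set net := (latticeBall n ⌊n / ε⌋₊).filter fun k =>
    ∀ j, (η / 2) ^ 2 ≤ ∑ i ∈ I k j, (h * k i) ^ 2
  have hsub : spreadEvent Γ a₁ b η (a₁ * ε) ⊆ ⋃ k ∈ net,
      {ω | ∑ j, (Γ ω).mulVec (fun i => h * k i) j ^ 2 ≤ 4 * a₁ ^ 2 * ε ^ 2 * N} := by
    rintro ω ⟨hA, x, hx, hbig, hΓx⟩
    obtain ⟨k, hk, hk1, hkx⟩ := exists_lattice_approx (by omega) hε hx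
    simp only [Set.mem_iUnion]
    refine ⟨k, Finset.mem_filter.2 ⟨hk, fun j => ?_⟩, ?_⟩
    · have h1 := sum_filter_le_of_rowCondition (b := b) hrow ha₄ x j
      have h2 : κ * η ^ 2 / 4 * n * b ^ 2 ≤ η ^ 2 / 4 := by
        rw [hbsq, mul_one_div, div_le_iff₀ (by positivity)]
        have : 0 ≤ κ * η ^ 2 / 4 := by positivity
        nlinarith
      set J := Finset.univ.filter fun i => |x i| ≤ b ∧ 1 ≤ ∫ ω, (Γ ω j i) ^ 2 ∂P with hJ
      have hJI : J ⊆ I k j := fun i hi => by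
        simp only [hJ, hI, Finset.mem_filter, Finset.mem_univ, true_and] at hi ⊢
        exact ⟨(hk1 i).trans hi.1, hi.2⟩
      have h3 : ∑ i ∈ J, (h * k i) ^ 2 ≤ ∑ i ∈ I k j, (h * k i) ^ 2 :=
        Finset.sum_le_sum_of_subset_of_nonneg hJI fun _ _ _ => sq_nonneg _
      have h4 : ∑ i ∈ J, (x i - h * k i) ^ 2 ≤ ε ^ 2 :=
        (Finset.sum_le_sum_of_subset_of_nonneg (Finset.subset_univ J)
          fun _ _ _ => sq_nonneg _).trans hkx
      have h5 := sum_sq_le_two_mul_add J x fun i => h * k i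
      have h6 : ε ^ 2 ≤ (η / 3) ^ 2 := by gcongr
      nlinarith
    · refine (sum_mulVec_sq_le_of_approx _ hA hΓx hkx).trans (le_of_eq ?_)
      rw [mul_pow, mul_pow, Real.sq_sqrt hN.le]
      ring
  have hprob : ∀ k ∈ net,
      P.real {ω | ∑ j, (Γ ω).mulVec (fun i => h * k i) j ^ 2 ≤ 4 * a₁ ^ 2 * ε ^ 2 * N} ≤
        (C₀ * ε) ^ N := by
    intro k hk
    have h1 := hsingle P Γ hΓ hmom (fun i => h * k i) b (η / 2) ε (4 * a₁ ^ 2 * ε ^ 2 * N)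
      (I k) hb0 (by positivity) hε
      (fun j i hi => (Finset.mem_filter.1 hi).2) (Finset.mem_filter.1 hk).2
    refine h1.trans ?_
    have e1 : Real.exp (4 * a₁ ^ 2 * ε ^ 2 * N / (2 * ε ^ 2)) = Real.exp (2 * a₁ ^ 2) ^ N := by
      rw [← Real.exp_nat_mul]
      congr 1
      field_simp
      ring
    rw [e1, ← mul_pow, hC₀, mul_assoc]
    gcongr
    rw [add_mul]
    gcongr
    · apply le_of_eq; field_simp; ring
    · -- the condition `1 ≤ ε ^ 3 * N` is what makes the error `(b / ε) ^ 2` of order `ε`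
      rw [div_pow, hbsq, mul_pow, div_div, div_mul_eq_mul_div, one_mul,
        div_le_div_iff₀ (by positivity) (by positivity)]
      calc 1 * (κ * τ ^ 2) ≤ ε ^ 3 * N * (κ * τ ^ 2) := by gcongr
        _ = _ := by ring
  have hcard : (net.card : ℝ) ≤ (9 / ε) ^ n := by
    have h1 := card_latticeBall_floor_le n (L := n / ε) (t := ε) (by positivity) hε
    have h2 : (net.card : ℝ) ≤ (latticeBall n ⌊n / ε⌋₊).card := by
      exact_mod_cast Finset.card_filter_le _ _
    refine h2.trans (h1.trans ?_)
    have e1 : ε * (n / ε) = n * 1 := by field_simp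
    rw [e1, Real.exp_nat_mul, ← mul_pow]
    have h3 : 1 + 2 / ε ≤ 3 / ε := by
      rw [le_div_iff₀ hε, add_mul, div_mul_cancel₀ _ hε.ne']
      linarith
    have h4 : Real.exp 1 ≤ 3 := by linarith [Real.exp_one_lt_d9]
    gcongr
    calc _ ≤ 3 * (3 / ε) := by gcongr
      _ = _ := by ring
  calc _ ≤ P.real (⋃ k ∈ net, {ω | ∑ j, (Γ ω).mulVec (fun i => h * k i) j ^ 2 ≤
        4 * a₁ ^ 2 * ε ^ 2 * N}) := measureReal_mono hsub (measure_ne_top _ _)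
    _ ≤ ∑ k ∈ net, P.real {ω | ∑ j, (Γ ω).mulVec (fun i => h * k i) j ^ 2 ≤
        4 * a₁ ^ 2 * ε ^ 2 * N} := measureReal_biUnion_finset_le _ _
    _ ≤ ∑ _k ∈ net, (C₀ * ε) ^ N := Finset.sum_le_sum hprob
    _ = net.card * (C₀ * ε) ^ N := by rw [Finset.sum_const, nsmul_eq_mul]
    _ ≤ (9 / ε) ^ n * (C₀ * ε) ^ N := by gcongr
    _ = 9 ^ n * C₀ ^ N * ε ^ (N - n) := by
      rw [div_pow, mul_pow, ← pow_sub_mul_pow ε hnN]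
      field_simp
    _ ≤ 9 ^ N * C₀ ^ N * ε ^ (N - n) := by gcongr; norm_num
    _ = (9 * C₀) ^ N * ε ^ (N - n) := by rw [mul_pow 9]
    _ ≤ _ := by gcongr; exact le_max_right _ _

/-- Spread vectors exist only if `n` is proportional to `N`, since all `n` coordinates would have
to be of order at most `1 / √N`. -/
theorem spreadEvent_eq_empty {Ω : Type*} {N n : ℕ} (Γ : Ω → Matrix (Fin N) (Fin n) ℝ)
    {a₁ κ η ρ : ℝ} (hκ : 0 < κ) (hN : 0 < N) (h : (n : ℝ) ≤ κ * η ^ 2 * N) :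
    spreadEvent Γ a₁ (1 / √(κ * N)) η ρ = ∅ := by
  have hN' : (0 : ℝ) < N := by exact_mod_cast hN
  refine Set.eq_empty_of_forall_notMem ?_
  rintro ω ⟨-, x, -, hbig, -⟩
  refine hbig.not_ge ?_
  calc _ ≤ ∑ i with |x i| ≤ 1 / √(κ * N), (1 / √(κ * N)) ^ 2 := by
        refine Finset.sum_le_sum fun i hi => ?_
        rw [← sq_abs]
        exact pow_le_pow_left₀ (abs_nonneg _) (Finset.mem_filter.1 hi).2 2
    _ ≤ ∑ _i : Fin n, (1 / √(κ * N)) ^ 2 :=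
        Finset.sum_le_sum_of_subset_of_nonneg (Finset.filter_subset _ _) fun _ _ _ => sq_nonneg _
    _ = n / (κ * N) := by
        rw [Finset.sum_const, Finset.card_univ, Fintype.card_fin, nsmul_eq_mul, div_pow,
          Real.sq_sqrt (by positivity)]
        ring
    _ ≤ η ^ 2 := by
        rw [div_le_iff₀ (by positivity)]
        linarith

theorem setOf_smallestSingularValue_le_subset {Ω : Type*} {N n : ℕ} (hn : 1 ≤ n)
    (Γ : Ω → Matrix (Fin N) (Fin n) ℝ) {a₁ c ρ₁ ρ₂ : ℝ} (b η : ℝ) (hc : 0 ≤ c) (h₁ : c ≤ ρ₁)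
    (h₂ : c ≤ ρ₂) :
    {ω | smallestSingularValue (Γ ω) ≤ c * √(N : ℝ)} ⊆
      {ω | a₁ * √(N : ℝ) < spectralNorm2 (Γ ω)} ∪
        (sparseEvent Γ a₁ b η ρ₁ ∪ spreadEvent Γ a₁ b η ρ₂) := by
  intro ω hω
  rcases lt_or_ge (a₁ * √(N : ℝ)) (spectralNorm2 (Γ ω)) with h | h
  · exact Or.inl h
  obtain ⟨x, hx, hΓx⟩ := exists_sum_mulVec_sq_le_of_smallestSingularValue_le hn (Γ ω) hω
  rw [mul_pow, Real.sq_sqrt (Nat.cast_nonneg N)] at hΓx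
  have hle : ∀ ρ, c ≤ ρ → ∑ j, (Γ ω).mulVec x j ^ 2 ≤ ρ ^ 2 * N := fun ρ hρ =>
    hΓx.trans (by gcongr)
  rcases le_or_gt (∑ i with |x i| ≤ b, x i ^ 2) (η ^ 2) with h' | h'
  · exact Or.inr (Or.inl ⟨h, x, hx, h', hle _ h₁⟩)
  · exact Or.inr (Or.inr ⟨h, x, hx, h', hle _ h₂⟩)

end Nets

/-! ### Size conditions and the invertibility theorem -/

/-- The lower bound on `δ` turns into the lower bound `N ^ (-1 / 3)` for the scale `exp (-D / δ)`. -/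
theorem three_mul_div_le_log {D δ : ℝ} {n N : ℕ} (hδ : 0 < δ) (hn : 1 ≤ n)
    (hnN : n < N) (h : 6 * D / Real.log (2 + n) ≤ δ) : 3 * (D / δ) ≤ Real.log N := by
  have hn' : (1 : ℝ) ≤ n := by exact_mod_cast hn
  have hN' : (n : ℝ) + 1 ≤ N := by exact_mod_cast hnN
  have hlog : 0 < Real.log (2 + n) := Real.log_pos (by linarith)
  rw [div_le_iff₀ hlog] at h
  have h1 : Real.log (2 + n) ≤ 2 * Real.log N := by
    have : Real.log ((N : ℝ) ^ 2) = 2 * Real.log N := by rw [Real.log_pow]; push_cast; rfl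
    rw [← this]
    exact Real.log_le_log (by positivity) (by nlinarith)
  rw [mul_div_assoc', div_le_iff₀ hδ]
  nlinarith

/-- A large constant in the lower bound on `δ` excludes small values of `N`. -/
theorem half_le_of_div_log_le {A δ : ℝ} {n N : ℕ} (hA : 0 < A) (hn : 1 ≤ n)
    (hN : (N : ℝ) = (1 + δ) * n) (h : A / Real.log (2 + n) ≤ δ) : A / 2 ≤ N := by
  have hn' : (1 : ℝ) ≤ n := by exact_mod_cast hn
  have hlog : 0 < Real.log (2 + n) := Real.log_pos (by linarith)
  have h1 : Real.log (2 + n) ≤ 2 * n := by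
    have := Real.log_le_sub_one_of_pos (x := 2 + n) (by positivity)
    linarith
  rw [div_le_iff₀ hlog] at h
  have hδ : 0 < δ := by
    by_contra hcon
    nlinarith
  rw [hN]
  nlinarith

theorem theorem1p2 (r μ a₁ a₃ : ℝ) (hr : 2 < r) (hμ : 1 ≤ μ) (ha₁ : 0 < a₁)
    (ha₃ : 0 < a₃) (ha₃μ : a₃ < μ) :
    ∃ γ : ℝ, 0 < γ ∧ γ < 1 ∧
    ∃ c₁ : ℝ → ℝ, (∀ δ : ℝ, 0 < δ → 0 < c₁ δ) ∧
    ∀ a₂ a₄ : ℝ, 0 < a₂ → 0 < a₄ → a₄ ≤ 1 →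
    ∃ c₂ c₁' c₂' : ℝ, 0 < c₂ ∧ 0 < c₁' ∧ 0 < c₂' ∧
    ∀ (n N : ℕ) (δ : ℝ), 1 ≤ n → n < N → (N : ℝ) = (1 + δ) * n →
    ∀ {Ω : Type*} [MeasurableSpace Ω] (P : Measure Ω) [IsProbabilityMeasure P]
      (Γ : Ω → Matrix (Fin N) (Fin n) ℝ),
      HasIndepCenteredEntries P Γ →
      MomentCondition P Γ r μ →
      NormCondition P Γ a₁ a₂ →
      ColumnCondition P Γ a₃ →
      RowCondition P Γ a₄ →
      1 - γ < a₄ →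
      c₁' / Real.log (2 + c₂' * n) ≤ δ →
      P.real {ω | smallestSingularValue (Γ ω) ≤ c₁ δ * √(N : ℝ)} ≤ Real.exp (-c₂ * N) := by
  have hμ0 : 0 < μ := by linarith
  -- third moments suffice for the Taylor expansion, and higher ones give nothing more
  set p := min r 3
  have hp2 : 2 < p := lt_min hr (by norm_num)
  have hp3 : p ≤ 3 := min_le_right _ _
  set η := min (1 / 4) (a₃ / (12 * a₁)) with hη
  have hη0 : 0 < η := by positivity
  have hη4 : η ≤ 1 / 4 := min_le_left _ _
  have hηa : 12 * a₁ * η ≤ a₃ := by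
    have : η ≤ a₃ / (12 * a₁) := min_le_right _ _
    rwa [le_div_iff₀ (by positivity), mul_comm] at this
  obtain ⟨c, κ, hc, hκ, hsparse⟩ :=
    exists_measureReal_sparseEvent_le hμ0 hp2 hp3 ha₁ ha₃ hη0 hη4 hηa
  obtain ⟨C, hC, hspread⟩ :=
    exists_measureReal_spreadEvent_le (a₁ := a₁) hμ0 hp2 hp3 hη0 hκ
  have hlogC : 0 ≤ Real.log C := Real.log_nonneg hC
  have hlogη : 0 < Real.log (3 / η) := Real.log_pos (by rw [lt_div_iff₀ hη0]; linarith)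
  -- `D` makes `C ^ N * ε ^ (N - n) ≤ exp (-N)` for `ε = exp (-D / δ)` when `κ * η ^ 2 * N ≤ n`
  set D := (Real.log C + Real.log (3 / η) + 1) / (κ * η ^ 2) with hD
  have hD0 : 0 < D := by positivity
  have hDκ : D * (κ * η ^ 2) = Real.log C + Real.log (3 / η) + 1 :=
    div_mul_cancel₀ _ (by positivity)
  refine ⟨min (1 / 2) (κ * η ^ 2 / 4), by positivity,
    (min_le_left _ _).trans_lt (by norm_num),
    fun δ => min (a₃ / 8) (a₁ * Real.exp (-(D / δ))), fun δ hδ => by positivity, ?_⟩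
  intro a₂ a₄ ha₂ ha₄ ha₄1
  -- each of the three bad events has probability at most `exp (-2 * c₂ * N)`; the factor `3` is
  -- absorbed because `N ≥ log 3 / c₂`
  set c₂ := min a₂ (min c 1) / 2 with hc₂
  have hc₂0 : 0 < c₂ := by positivity
  have hca₂ : 2 * c₂ ≤ a₂ := by
    rw [hc₂, mul_div_cancel₀ _ two_ne_zero]; exact min_le_left _ _
  have hcc : 2 * c₂ ≤ c := by
    rw [hc₂, mul_div_cancel₀ _ two_ne_zero]; exact (min_le_right _ _).trans (min_le_left _ _)
  have hc1 : 2 * c₂ ≤ 1 := by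
    rw [hc₂, mul_div_cancel₀ _ two_ne_zero]; exact (min_le_right _ _).trans (min_le_right _ _)
  set c₁' := max (6 * D) (2 * (Real.log 3 / c₂)) with hc₁'
  refine ⟨c₂, c₁', 1, hc₂0, by positivity, one_pos, ?_⟩
  intro n N δ hn hnN hNδ Ω _ P _ Γ hΓ hmom hnorm hcol hrow ha₄γ hδ
  rw [one_mul] at hδ
  have hn' : (1 : ℝ) ≤ n := by exact_mod_cast hn
  have hnN' : (n : ℝ) < N := by exact_mod_cast hnN
  have hN0 : (0 : ℝ) < N := by linarith
  have hδ0 : 0 < δ := by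
    by_contra hcon
    nlinarith
  have hlog : 0 < Real.log (2 + n) := Real.log_pos (by linarith)
  have hDδ : 3 * (D / δ) ≤ Real.log N :=
    three_mul_div_le_log hδ0 hn hnN
      ((div_le_div_of_nonneg_right (le_max_left _ _) hlog.le).trans hδ)
  have hN3 : Real.log 3 ≤ c₂ * N := by
    have := half_le_of_div_log_le (by positivity) hn hNδ
      ((div_le_div_of_nonneg_right (le_max_right _ _) hlog.le).trans hδ)
    rw [mul_div_cancel_left₀ _ two_ne_zero, div_le_iff₀ hc₂0] at this
    linarith
  have hmom' : MomentCondition P Γ p μ := fun j i =>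
    moment_le_of_moment_le hμ0 (by linarith) (min_le_left _ _) (hΓ.measurable_entry j i)
      (hmom j i).1 (hmom j i).2
  set ε := Real.exp (-(D / δ)) with hε
  have hspread' : P.real (spreadEvent Γ a₁ (1 / √(κ * N)) η (a₁ * ε)) ≤ Real.exp (-N) := by
    rcases le_or_gt (n : ℝ) (κ * η ^ 2 * N) with hsmall | hlarge
    · rw [spreadEvent_eq_empty Γ hκ (by omega) hsmall, measureReal_empty]
      positivity
    -- here `n` is proportional to `N`, so `δ` is bounded and `ε` is small
    have hδκ : κ * η ^ 2 ≤ 1 / δ := by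
      rw [le_div_iff₀ hδ0]
      rw [hNδ] at hlarge
      have h0 : 0 < κ * η ^ 2 := by positivity
      by_contra hcon
      nlinarith
    have hDδ' : Real.log C + Real.log (3 / η) + 1 ≤ D / δ := by
      rw [← hDκ, div_eq_mul_one_div]
      gcongr
    have hεη : ε ≤ η / 3 := by
      rw [hε, ← Real.exp_log (by positivity : 0 < η / 3), Real.exp_le_exp]
      have : Real.log (η / 3) = -Real.log (3 / η) := by rw [← Real.log_inv, inv_div]
      linarith
    have hε1 : ε ≤ 1 := by linarith
    have hεN : 1 ≤ ε ^ 3 * N := by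
      rw [hε, ← Real.exp_nat_mul, ← Real.exp_log hN0, ← Real.exp_add]
      refine Real.one_le_exp ?_
      push_cast
      linarith
    have hγ : 1 - κ * η ^ 2 / 4 < a₄ := by
      have := min_le_right (1 / 2) (κ * η ^ 2 / 4)
      linarith
    refine (hspread P Γ a₄ ε hn hnN.le hΓ hmom' hrow hγ (Real.exp_pos _) hε1 hεη hεN).trans ?_
    have e1 : C ^ N = Real.exp (N * Real.log C) := by
      rw [Real.exp_nat_mul, Real.exp_log (by linarith)]
    have e2 : ε ^ (N - n) = Real.exp (-(D * n)) := by
      rw [hε, ← Real.exp_nat_mul, Nat.cast_sub hnN.le, hNδ]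
      congr 1
      field_simp
      ring
    rw [e1, e2, ← Real.exp_add, Real.exp_le_exp]
    have h1 : D * (κ * η ^ 2) * N ≤ D * n := by
      rw [mul_assoc]
      gcongr
    rw [hDκ] at h1
    have h2 : 0 ≤ Real.log (3 / η) * N := by positivity
    linarith only [h1, h2]
  have hsub := setOf_smallestSingularValue_le_subset hn Γ (a₁ := a₁)
    (c := min (a₃ / 8) (a₁ * ε)) (1 / √(κ * N)) η (by positivity) (min_le_left _ _)
    (min_le_right _ _)
  have hexp : ∀ a, 2 * c₂ ≤ a → Real.exp (-a * N) ≤ Real.exp (-(2 * c₂) * N) := by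
    intro a ha
    gcongr
  calc _ ≤ P.real ({ω | a₁ * √(N : ℝ) < spectralNorm2 (Γ ω)} ∪
        (sparseEvent Γ a₁ (1 / √(κ * N)) η (a₃ / 8) ∪
          spreadEvent Γ a₁ (1 / √(κ * N)) η (a₁ * ε))) := measureReal_mono hsub
    _ ≤ Real.exp (-a₂ * N) + (Real.exp (-c * N) + Real.exp (-1 * N)) := by
      refine (measureReal_union_le _ _).trans (add_le_add hnorm ?_)
      refine (measureReal_union_le _ _).trans (add_le_add ?_ ?_)
      · exact hsparse P Γ hn hnN.le hΓ hmom' hcol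
      · rwa [neg_one_mul]
    _ ≤ 3 * Real.exp (-(2 * c₂) * N) := by
      have h1 := hexp a₂ hca₂
      have h2 := hexp c hcc
      have h3 := hexp 1 hc1
      linarith
    _ = Real.exp (Real.log 3 + -(2 * c₂) * N) := by
      rw [Real.exp_add, Real.exp_log (by norm_num)]
    _ ≤ _ := by
      rw [Real.exp_le_exp]
      linarith only [hN3]
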